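/- Let $G,\hbar,c,e,m_e,M>0$ be real constants (Newton's constant, reduced Planck constant, speed of light, elementary charge in Gaussian units, electron mass, nuclear mass) and let $Z\ge 1$ be an integer. Assume that either $\frac{Z^2e^2}{GM^2}<1$ (subextremal case) or $\frac{Z^2e^2}{GM^2}=1$ (extremal case). Put $\alpha_S=\frac{e^2}{\hbar c}$, $$f^2(r)=1-\frac{2GMm_e}{\hbar c}\,\frac1r+\frac{Gm_e^2}{\hbar c}\,\frac{Z^2e^2}{\hbar c}\,\frac1{r^2},\qquad r_-=\frac{GMm_e}{\hbar c}\Bigl(1-\sqrt{1-\tfrac{Z^2e^2}{GM^2}}\Bigr),$$ and $f=\sqrt{f^2}>0$ on $(0,r_-)$. Let $x\mapsto r(x)$, $(0,\infty)\to(0,r_-)$, be the inverse of the bijection $r\mapsto x=\int_0^r\frac{ds}{f^2(s)}$. For $k\in\mathbb Z\setminus\{0\}$ and an amplitude $\mathfrak{f}\in\mathbb R$ of the anomalous magnetic moment, let $\widetilde K_k^{\mathfrak f}$ be the operator in $L^2((0,\infty),dx;\mathbb C^2)$ with domain $C_c^\infty((0,\infty);\mathbb C^2)$ given by $$\widetilde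 K_k^{\mathfrak f}=\begin{pmatrix} a-b & kc-\mathfrak f d-\frac{d}{dx}\\ kc-\mathfrak f d+\frac{d}{dx} & -a-b\end{pmatrix},$$ where $$a(x)=f(r(x)),\quad b(x)=\frac{Z\alpha_S}{r(x)},\quad c(x)=\frac{f(r(x))}{r(x)},\quad d(x)=\frac{Z\alpha_S^2}{4\pi}\,\frac{f(r(x))}{r(x)^2}$$ (in the operator, $c$ and $d$ denote these functions and not physical constants). **Theorem.** In both the subextremal and the extremal case, $\widetilde K_k^{\mathfrak f}$ is essentially self-adjoint (it is densely defined and closable, and its closure is self-adjoint) if and only if $$|\mathfrak f|\,\frac{e^3}{4\pi m_ec^2}\;\ge\;\frac32\,\frac{\sqrt G\,\hbar}{c}.$$ In particular it is essentially self-adjoint if $\mathfrak f\,\frac{e^3}{4\pi m_ec^2}\ge\frac32\frac{\sqrt G\,\hbar}{c}$. -/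

import Mathlib

open MeasureTheory Set Filter
open scoped Topology ContDiff Distributions

noncomputable section

/-- The physical constants of the model, as real numbers in Gaussian units: Newton's constant `G`,
the reduced Planck constant `hbar`, the speed of light `c`, the elementary charge `e`, the electron
mass `m`, the nuclear (ADM) mass `M` and the nuclear charge number `Z`. -/
structure RWNData where
  G : ℝ
  hbar : ℝ
  c : ℝ
  e : ℝ
  m : ℝ
  M : ℝ
  Z : ℕ
  G_pos : 0 < G
  hbar_pos : 0 < hbar
  c_pos : 0 < c
  e_pos : 0 < e
  m_pos : 0 < m
  M_pos : 0 < M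
  Z_pos : 0 < Z

namespace RWNData

variable (p : RWNData)

/-- The subextremal black-hole sector `Z² e² / (G M²) < 1`. -/
def IsSubextremal : Prop := (p.Z : ℝ) ^ 2 * p.e ^ 2 / (p.G * p.M ^ 2) < 1

/-- The extremal black-hole case `Z² e² / (G M²) = 1`. -/
def IsExtremal : Prop := (p.Z : ℝ) ^ 2 * p.e ^ 2 / (p.G * p.M ^ 2) = 1

/-- The fine structure constant `α_S = e² / (ħ c)`. -/
def alphaS : ℝ := p.e ^ 2 / (p.hbar * p.c)

/-- The metric coefficient `f²(r)`, with `r` measured in units of `ħ / (m c)`. -/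
def fSq (r : ℝ) : ℝ :=
  1 - 2 * (p.G * p.M * p.m / (p.hbar * p.c)) * (1 / r)
    + (p.G * p.m ^ 2 / (p.hbar * p.c)) * ((p.Z : ℝ) ^ 2 * p.e ^ 2 / (p.hbar * p.c)) * (1 / r ^ 2)

/-- The positive square root `f(r)` of `f²(r)`. -/
def f (r : ℝ) : ℝ := √(p.fSq r)

/-- The inner (Cauchy) horizon radius; it is the event horizon radius in the extremal case. -/
def rMinus : ℝ :=
  p.G * p.M * p.m / (p.hbar * p.c) * (1 - √(1 - (p.Z : ℝ) ^ 2 * p.e ^ 2 / (p.G * p.M ^ 2)))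

/-- The outer horizon radius. -/
def rPlus : ℝ :=
  p.G * p.M * p.m / (p.hbar * p.c) * (1 + √(1 - (p.Z : ℝ) ^ 2 * p.e ^ 2 / (p.G * p.M ^ 2)))

/-- The coordinate `x` on the static interior `0 < r < r₋`, determined by `dx/dr = 1 / f²(r)` and
`x = 0` at `r = 0`. The integrand extends continuously by `0` to `s = 0`, so that the integral exists
for `0 ≤ r < r₋`. -/
def xOfR (r : ℝ) : ℝ := ∫ s in (0 : ℝ)..r, 1 / p.fSq s

/-- The inverse `x ↦ r(x)`, from `(0, ∞)` to `(0, r₋)`, of the coordinate change, which is a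
bijection of `(0, r₋)` onto `(0, ∞)`, see `bijOn_xOfR`. -/
def rOfX (x : ℝ) : ℝ := Function.invFunOn p.xOfR (Ioo 0 p.rMinus) x

/-- `a(x) = f(r(x))`. -/
def coeffA (x : ℝ) : ℝ := p.f (p.rOfX x)

/-- `b(x) = Z α_S / r(x)`. -/
def coeffB (x : ℝ) : ℝ := p.Z * p.alphaS * (1 / p.rOfX x)

/-- `c(x) = f(r(x)) / r(x)`. -/
def coeffC (x : ℝ) : ℝ := 1 / p.rOfX x * p.f (p.rOfX x)

/-- `d(x) = Z α_S² / (4 π) · f(r(x)) / r(x)²`. -/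
def coeffD (x : ℝ) : ℝ :=
  p.Z * p.alphaS ^ 2 * (1 / (4 * Real.pi)) * (1 / p.rOfX x ^ 2) * p.f (p.rOfX x)

/-- The off-diagonal potential `k c(x) - 𝔣 d(x)`, where `amp` is the amplitude `𝔣` of the anomalous
magnetic moment. -/
def offDiag (k : ℤ) (amp : ℝ) (x : ℝ) : ℝ := k * p.coeffC x - amp * p.coeffD x

/-- The value spaces `ℂ²` of the radial bi-spinors. -/
abbrev C2 : Type := EuclideanSpace ℂ (Fin 2)

/-- The half line `(0, ∞)` as an open set. -/
def halfLine : TopologicalSpace.Opens ℝ := ⟨Ioi 0, isOpen_Ioi⟩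

/-- The Hilbert space `L²((0, ∞), dx; ℂ²)`. -/
abbrev HSpace : Type := Lp C2 2 ((volume : Measure ℝ).restrict (Ioi 0))

/-- The radial Dirac differential expression
`(a - b, k c - 𝔣 d - d/dx; k c - 𝔣 d + d/dx, -a - b)` applied to `g = (g₁, g₂)`. -/
def diracExpr (k : ℤ) (amp : ℝ) (g : ℝ → C2) (x : ℝ) : C2 :=
  !₂[((p.coeffA x - p.coeffB x : ℝ) : ℂ) * g x 0
        + ((p.offDiag k amp x : ℝ) : ℂ) * g x 1 - deriv (fun y => g y 1) x,
     ((p.offDiag k amp x : ℝ) : ℂ) * g x 0 + deriv (fun y => g y 0) x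
        + ((-p.coeffA x - p.coeffB x : ℝ) : ℂ) * g x 1]

/-! ### The coordinate change is a homeomorphism of `(0, r₋)` onto `(0, ∞)` -/

variable {p}

lemma charge_ratio_pos : 0 < (p.Z : ℝ) ^ 2 * p.e ^ 2 / (p.G * p.M ^ 2) := by
  have := p.G_pos; have := p.M_pos; have := p.e_pos
  have : (0 : ℝ) < p.Z := by exact_mod_cast p.Z_pos
  positivity

lemma length_pos : 0 < p.G * p.M * p.m / (p.hbar * p.c) := by
  have := p.G_pos; have := p.M_pos; have := p.m_pos; have := p.hbar_pos; have := p.c_pos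
  positivity

lemma ratio_le (h : p.IsSubextremal ∨ p.IsExtremal) :
    (p.Z : ℝ) ^ 2 * p.e ^ 2 / (p.G * p.M ^ 2) ≤ 1 :=
  h.elim (fun h => le_of_lt h) (fun h => le_of_eq h)

lemma rMinus_pos : 0 < p.rMinus := by
  refine mul_pos length_pos ?_
  rw [sub_pos, Real.sqrt_lt' one_pos]
  linarith [charge_ratio_pos (p := p)]

lemma rMinus_le_rPlus : p.rMinus ≤ p.rPlus := by
  unfold rMinus rPlus
  have := Real.sqrt_nonneg (1 - (p.Z : ℝ) ^ 2 * p.e ^ 2 / (p.G * p.M ^ 2))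
  have := length_pos (p := p)
  gcongr
  linarith

lemma fSq_eq (h : p.IsSubextremal ∨ p.IsExtremal) {r : ℝ} (hr : r ≠ 0) :
    p.fSq r = (p.rPlus - r) * (p.rMinus - r) / r ^ 2 := by
  have hs := Real.sq_sqrt (sub_nonneg.2 (ratio_le h))
  have hG := p.G_pos.ne'; have hM := p.M_pos.ne'; have hh := p.hbar_pos.ne'; have hc := p.c_pos.ne'
  have hprod : p.rPlus * p.rMinus
      = (p.G * p.m ^ 2 / (p.hbar * p.c)) * ((p.Z : ℝ) ^ 2 * p.e ^ 2 / (p.hbar * p.c)) := by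
    have : p.rPlus * p.rMinus = (p.G * p.M * p.m / (p.hbar * p.c)) ^ 2
        * (1 - √(1 - (p.Z : ℝ) ^ 2 * p.e ^ 2 / (p.G * p.M ^ 2)) ^ 2) := by
      unfold rPlus rMinus; ring
    rw [this, hs]
    field_simp
    ring
  have hsum : p.rPlus + p.rMinus = 2 * (p.G * p.M * p.m / (p.hbar * p.c)) := by
    unfold rPlus rMinus; ring
  unfold fSq
  rw [← hprod, ← hsum]
  field_simp
  ring

lemma fSq_pos (h : p.IsSubextremal ∨ p.IsExtremal) {r : ℝ} (hr : r ∈ Ioo 0 p.rMinus) :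
    0 < p.fSq r := by
  have h1 := hr.1
  have h2 := hr.2
  have h3 := rMinus_le_rPlus (p := p)
  rw [fSq_eq h h1.ne']
  exact div_pos (mul_pos (by linarith) (by linarith)) (by positivity)

lemma xOfR_eq (h : p.IsSubextremal ∨ p.IsExtremal) (r : ℝ) :
    p.xOfR r = ∫ s in (0 : ℝ)..r, s ^ 2 / ((p.rPlus - s) * (p.rMinus - s)) := by
  unfold xOfR
  refine intervalIntegral.integral_congr_ae ?_
  filter_upwards [compl_mem_ae_iff.2 (measure_singleton (0 : ℝ) (μ := volume))] with s hs _
  rw [fSq_eq h hs, one_div_div]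

lemma continuousOn_integrand :
    ContinuousOn (fun s : ℝ => s ^ 2 / ((p.rPlus - s) * (p.rMinus - s))) (Iio p.rMinus) := by
  intro s hs
  have h3 := rMinus_le_rPlus (p := p)
  have hs' : s < p.rMinus := hs
  have : (p.rPlus - s) * (p.rMinus - s) ≠ 0 :=
    (mul_pos (by linarith) (by linarith)).ne'
  exact ContinuousAt.continuousWithinAt (by fun_prop (disch := assumption))

lemma hasDerivAt_xOfR (h : p.IsSubextremal ∨ p.IsExtremal) {r : ℝ} (hr : r ∈ Ioo 0 p.rMinus) :
    HasDerivAt p.xOfR (1 / p.fSq r) r := by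
  have hev : p.xOfR =ᶠ[𝓝 r]
      fun r => ∫ s in (0 : ℝ)..r, s ^ 2 / ((p.rPlus - s) * (p.rMinus - s)) := by
    exact Eventually.of_forall fun s => xOfR_eq h s
  refine HasDerivAt.congr_of_eventuallyEq ?_ hev
  rw [fSq_eq h hr.1.ne', one_div_div]
  refine intervalIntegral.integral_hasDerivAt_right ?_ ?_ ?_
  · refine (continuousOn_integrand.mono ?_).intervalIntegrable
    rw [uIcc_of_le hr.1.le]
    exact fun s hs => lt_of_le_of_lt hs.2 hr.2
  · exact continuousOn_integrand.stronglyMeasurableAtFilter isOpen_Iio r hr.2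
  · exact continuousOn_integrand.continuousAt (isOpen_Iio.mem_nhds hr.2)

lemma strictMonoOn_xOfR (h : p.IsSubextremal ∨ p.IsExtremal) :
    StrictMonoOn p.xOfR (Ioo 0 p.rMinus) := by
  refine strictMonoOn_of_deriv_pos (convex_Ioo _ _)
    (fun _ hr => (hasDerivAt_xOfR h hr).continuousAt.continuousWithinAt) ?_
  intro r hr
  rw [interior_Ioo] at hr
  rw [(hasDerivAt_xOfR h hr).deriv]
  exact one_div_pos.2 (fSq_pos h hr)

lemma tendsto_xOfR_zero (h : p.IsSubextremal ∨ p.IsExtremal) :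
    Tendsto p.xOfR (𝓝[>] 0) (𝓝 0) := by
  have hd : HasDerivAt (fun r => ∫ s in (0 : ℝ)..r, s ^ 2 / ((p.rPlus - s) * (p.rMinus - s)))
      ((0 : ℝ) ^ 2 / ((p.rPlus - 0) * (p.rMinus - 0))) 0 :=
    intervalIntegral.integral_hasDerivAt_right (by simp)
      (continuousOn_integrand.stronglyMeasurableAtFilter isOpen_Iio 0 rMinus_pos)
      (continuousOn_integrand.continuousAt (isOpen_Iio.mem_nhds rMinus_pos))
  have ht := hd.continuousAt.tendsto
  rw [intervalIntegral.integral_same] at ht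
  refine Tendsto.congr' ?_ (ht.mono_left nhdsWithin_le_nhds)
  exact Eventually.of_forall fun r => (xOfR_eq h r).symm

lemma tendsto_xOfR_rMinus (h : p.IsSubextremal ∨ p.IsExtremal) :
    Tendsto p.xOfR (𝓝[<] p.rMinus) atTop := by
  have hm := rMinus_pos (p := p)
  have hmp := rMinus_le_rPlus (p := p)
  set q := p.rMinus / 2 with hq
  have hq0 : 0 < q := by positivity
  have hqm : q < p.rMinus := by rw [hq]; linarith
  set C := q ^ 2 / p.rPlus with hC
  have hPp : 0 < p.rPlus := lt_of_lt_of_le hm hmp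
  have hC0 : 0 < C := by positivity
  -- the function `x(r) + C log (r₋ - r)` is increasing on `[r₋/2, r₋)`
  have hmono : MonotoneOn (fun r => p.xOfR r + C * Real.log (p.rMinus - r)) (Ico q p.rMinus) := by
    have hder : ∀ r ∈ Ico q p.rMinus,
        HasDerivAt (fun r => p.xOfR r + C * Real.log (p.rMinus - r))
          (1 / p.fSq r + C * (-1 / (p.rMinus - r))) r := by
      intro r hr
      have h1 : 0 < r := lt_of_lt_of_le hq0 hr.1
      have h2 : p.rMinus - r ≠ 0 := (sub_pos.2 hr.2).ne'
      exact (hasDerivAt_xOfR h ⟨h1, hr.2⟩).add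
        ((((hasDerivAt_id r).const_sub p.rMinus).log h2).const_mul C)
    refine monotoneOn_of_deriv_nonneg (convex_Ico _ _)
      (fun r hr => (hder r hr).continuousAt.continuousWithinAt)
      (fun r hr => (hder r (interior_subset hr)).differentiableAt.differentiableWithinAt) ?_
    intro r hr
    have hr := interior_subset hr
    rw [(hder r hr).deriv]
    have h1 : 0 < r := lt_of_lt_of_le hq0 hr.1
    have h2 : 0 < p.rMinus - r := sub_pos.2 hr.2
    have h3 : 0 < p.rPlus - r := by linarith
    rw [fSq_eq h h1.ne', one_div_div]
    have h4 : C / (p.rMinus - r) ≤ r ^ 2 / ((p.rPlus - r) * (p.rMinus - r)) := by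
      rw [← div_div]
      have h6 : C ≤ r ^ 2 / (p.rPlus - r) :=
        div_le_div₀ (sq_nonneg r) (pow_le_pow_left₀ hq0.le hr.1 2) h3 (by linarith)
      exact div_le_div_of_nonneg_right h6 h2.le
    have h5 : C * (-1 / (p.rMinus - r)) = -(C / (p.rMinus - r)) := by ring
    rw [h5]
    linarith
  have hsub : Tendsto (fun r => p.rMinus - r) (𝓝[<] p.rMinus) (𝓝[>] 0) := by
    refine tendsto_nhdsWithin_iff.2 ⟨?_, ?_⟩
    · have : Tendsto (fun r => p.rMinus - r) (𝓝 p.rMinus) (𝓝 (p.rMinus - p.rMinus)) :=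
        (continuous_const.sub continuous_id).tendsto _
      rw [sub_self] at this
      exact this.mono_left nhdsWithin_le_nhds
    · filter_upwards [self_mem_nhdsWithin] with r hr using sub_pos.2 (mem_Iio.1 hr)
  have hlog : Tendsto (fun r => -(C * Real.log (p.rMinus - r))) (𝓝[<] p.rMinus) atTop :=
    tendsto_neg_atBot_atTop.comp
      ((Real.tendsto_log_nhdsGT_zero.comp hsub).const_mul_atBot hC0)
  refine tendsto_atTop_mono' _ ?_
    (tendsto_atTop_add_const_left _ (p.xOfR q + C * Real.log (p.rMinus - q)) hlog)
  filter_upwards [Ico_mem_nhdsLT hqm] with r hr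
  have := hmono ⟨le_refl q, hqm⟩ hr hr.1
  simp only at this
  linarith

lemma bijOn_xOfR (h : p.IsSubextremal ∨ p.IsExtremal) :
    BijOn p.xOfR (Ioo 0 p.rMinus) (Ioi 0) := by
  have hmono := strictMonoOn_xOfR h
  have hcont : ContinuousOn p.xOfR (Ioo 0 p.rMinus) :=
    fun r hr => (hasDerivAt_xOfR h hr).continuousAt.continuousWithinAt
  refine ⟨?_, hmono.injOn, ?_⟩
  · intro r hr
    -- compare with the value at `r / 2`, which is at least the limit at `0`
    have hr2 : r / 2 ∈ Ioo 0 p.rMinus := ⟨by linarith [hr.1], by linarith [hr.1, hr.2]⟩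
    have h1 : 0 ≤ p.xOfR (r / 2) := by
      refine le_of_tendsto (tendsto_xOfR_zero h) ?_
      filter_upwards [Ioo_mem_nhdsGT hr2.1] with s hs
      exact (hmono ⟨hs.1, hs.2.trans hr2.2⟩ hr2 hs.2).le
    exact lt_of_le_of_lt h1 (hmono hr2 hr (by linarith [hr.1]))
  · intro y hy
    have hy : 0 < y := hy
    obtain ⟨r₁, hy₁, hr₁⟩ := (((tendsto_xOfR_zero h).eventually (gt_mem_nhds hy)).and
      (Ioo_mem_nhdsGT (rMinus_pos (p := p)))).exists
    obtain ⟨r₂, hy₂, hr₂⟩ := (((tendsto_xOfR_rMinus h).eventually (eventually_gt_atTop y)).and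
      (Ioo_mem_nhdsLT (rMinus_pos (p := p)))).exists
    exact isPreconnected_Ioo.intermediate_value hr₁ hr₂ hcont ⟨hy₁.le, hy₂.le⟩

lemma rOfX_mem (h : p.IsSubextremal ∨ p.IsExtremal) {x : ℝ} (hx : 0 < x) :
    p.rOfX x ∈ Ioo 0 p.rMinus :=
  Function.invFunOn_mem ((bijOn_xOfR h).surjOn hx)

lemma xOfR_rOfX (h : p.IsSubextremal ∨ p.IsExtremal) {x : ℝ} (hx : 0 < x) :
    p.xOfR (p.rOfX x) = x :=
  Function.invFunOn_eq ((bijOn_xOfR h).surjOn hx)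

lemma strictMonoOn_rOfX (h : p.IsSubextremal ∨ p.IsExtremal) :
    StrictMonoOn p.rOfX (Ioi 0) := by
  intro x hx y hy hxy
  rw [← (strictMonoOn_xOfR h).lt_iff_lt (rOfX_mem h hx) (rOfX_mem h hy),
    xOfR_rOfX h hx, xOfR_rOfX h hy]
  exact hxy

lemma continuousOn_rOfX (h : p.IsSubextremal ∨ p.IsExtremal) :
    ContinuousOn p.rOfX (Ioi 0) := by
  intro x hx
  refine ((strictMonoOn_rOfX h).continuousAt_of_image_mem_nhds (isOpen_Ioi.mem_nhds hx)
    ?_).continuousWithinAt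
  have himg : p.rOfX '' Ioi 0 = Ioo 0 p.rMinus := by
    refine Subset.antisymm (image_subset_iff.2 fun x hx => rOfX_mem h hx) ?_
    intro r hr
    have hx := (bijOn_xOfR h).mapsTo hr
    exact ⟨p.xOfR r, hx, (bijOn_xOfR h).injOn (rOfX_mem h hx) hr (xOfR_rOfX h hx)⟩
  rw [himg]
  exact isOpen_Ioo.mem_nhds (rOfX_mem h hx)

lemma continuousOn_f : ContinuousOn p.f (Ioi 0) := by
  intro r hr
  have hr : r ≠ 0 := (mem_Ioi.1 hr).ne'
  have hr2 : r ^ 2 ≠ 0 := pow_ne_zero 2 hr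
  refine ContinuousAt.continuousWithinAt ?_
  unfold f fSq
  fun_prop (disch := assumption)

lemma continuousOn_coeffs (h : p.IsSubextremal ∨ p.IsExtremal) :
    ContinuousOn p.coeffA (Ioi 0) ∧ ContinuousOn p.coeffB (Ioi 0) ∧
      ContinuousOn p.coeffC (Ioi 0) ∧ ContinuousOn p.coeffD (Ioi 0) := by
  have hr := continuousOn_rOfX h
  have hA : ContinuousOn p.coeffA (Ioi 0) :=
    continuousOn_f.comp hr fun x hx => (rOfX_mem h hx).1
  have h1 : ContinuousOn (fun x => 1 / p.rOfX x) (Ioi 0) :=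
    continuousOn_const.div hr fun x hx => (rOfX_mem h hx).1.ne'
  have h2 : ContinuousOn (fun x => 1 / p.rOfX x ^ 2) (Ioi 0) :=
    continuousOn_const.div (hr.pow 2) fun x hx => pow_ne_zero 2 (rOfX_mem h hx).1.ne'
  exact ⟨hA, continuousOn_const.mul h1, h1.mul hA, (continuousOn_const.mul h2).mul hA⟩

lemma continuousOn_offDiag (h : p.IsSubextremal ∨ p.IsExtremal) (k : ℤ) (amp : ℝ) :
    ContinuousOn (p.offDiag k amp) (Ioi 0) := by
  obtain ⟨-, -, hC, hD⟩ := continuousOn_coeffs h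
  exact (continuousOn_const.mul hC).sub (continuousOn_const.mul hD)

/-! ### The minimal operator on smooth bi-spinors with compact support in `(0, ∞)` -/

lemma contDiff_comp (g : 𝓓(halfLine, C2)) (i : Fin 2) : ContDiff ℝ ∞ fun y => g y i :=
  (contDiff_piLp 2).1 g.contDiff i

lemma diracExpr_add (k : ℤ) (amp : ℝ) (g₁ g₂ : 𝓓(halfLine, C2)) :
    p.diracExpr k amp (g₁ + g₂ : 𝓓(halfLine, C2)) = p.diracExpr k amp g₁ + p.diracExpr k amp g₂ := by
  have hd (g : 𝓓(halfLine, C2)) (i : Fin 2) : Differentiable ℝ fun y => g y i :=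
    (contDiff_comp g i).differentiable (by simp)
  have h (i : Fin 2) (x : ℝ) : deriv (fun y => g₁ y i + g₂ y i) x
      = deriv (fun y => g₁ y i) x + deriv (fun y => g₂ y i) x :=
    deriv_add (hd g₁ i x) (hd g₂ i x)
  funext x
  ext i
  fin_cases i
  · simp [diracExpr, h]; ring
  · simp [diracExpr, h]; ring

lemma diracExpr_smul (k : ℤ) (amp : ℝ) (z : ℂ) (g : 𝓓(halfLine, C2)) :
    p.diracExpr k amp (z • g : 𝓓(halfLine, C2)) = z • p.diracExpr k amp g := by
  funext x
  ext i
  fin_cases i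
  · simp [diracExpr]; ring
  · simp [diracExpr]; ring

lemma diracExpr_eq_zero (k : ℤ) (amp : ℝ) (g : 𝓓(halfLine, C2)) {x : ℝ}
    (hx : x ∉ tsupport g) : p.diracExpr k amp g x = 0 := by
  have hev : ⇑g =ᶠ[𝓝 x] 0 := notMem_tsupport_iff_eventuallyEq.1 hx
  have hd (i : Fin 2) : deriv (fun y => g y i) x = 0 := by
    have : (fun y => g y i) =ᶠ[𝓝 x] fun _ => (0 : ℂ) := by
      filter_upwards [hev] with y hy
      simp [hy]
    rw [this.deriv_eq, deriv_const]
  have h0 : g x = 0 := hev.self_of_nhds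
  unfold diracExpr
  ext i
  fin_cases i <;> simp [hd, h0]

lemma continuous_diracExpr (h : p.IsSubextremal ∨ p.IsExtremal) (k : ℤ) (amp : ℝ)
    (g : 𝓓(halfLine, C2)) : Continuous (p.diracExpr k amp g) := by
  rw [continuous_iff_continuousAt]
  intro x
  by_cases hx : x ∈ tsupport g
  · have hx0 : Ioi (0 : ℝ) ∈ 𝓝 x := isOpen_Ioi.mem_nhds (g.tsupport_subset hx)
    obtain ⟨hA, hB, -, -⟩ := continuousOn_coeffs h
    have hA := hA.continuousAt hx0
    have hB := hB.continuousAt hx0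
    have hV := (continuousOn_offDiag h k amp).continuousAt hx0
    have hg (i : Fin 2) : ContinuousAt (fun y => g y i) x :=
      (contDiff_comp g i).continuous.continuousAt
    have hd (i : Fin 2) : ContinuousAt (deriv fun y => g y i) x :=
      ((contDiff_comp g i).continuous_deriv (by simp)).continuousAt
    refine (PiLp.continuous_toLp 2 _).continuousAt.comp (continuousAt_pi.2 fun i => ?_)
    fin_cases i
    · exact ((Complex.continuous_ofReal.continuousAt.comp (hA.sub hB)).mul (hg 0)).add
        ((Complex.continuous_ofReal.continuousAt.comp hV).mul (hg 1)) |>.sub (hd 1)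
    · exact (((Complex.continuous_ofReal.continuousAt.comp hV).mul (hg 0)).add (hd 0)).add
        ((Complex.continuous_ofReal.continuousAt.comp (hA.neg.sub hB)).mul (hg 1))
  · have : p.diracExpr k amp g =ᶠ[𝓝 x] fun _ => 0 := by
      filter_upwards [(isClosed_tsupport g).isOpen_compl.mem_nhds hx] with y hy
        using diracExpr_eq_zero k amp g hy
    exact continuousAt_const.congr this.symm

lemma memLp_testFunction (g : 𝓓(halfLine, C2)) :
    MemLp g 2 ((volume : Measure ℝ).restrict (Ioi 0)) :=
  (g.continuous.memLp_of_hasCompactSupport g.hasCompactSupport).restrict _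

lemma memLp_diracExpr (h : p.IsSubextremal ∨ p.IsExtremal) (k : ℤ) (amp : ℝ)
    (g : 𝓓(halfLine, C2)) :
    MemLp (p.diracExpr k amp g) 2 ((volume : Measure ℝ).restrict (Ioi 0)) :=
  ((continuous_diracExpr h k amp g).memLp_of_hasCompactSupport
    (HasCompactSupport.intro g.hasCompactSupport
      fun _ hx => diracExpr_eq_zero k amp g hx)).restrict _

/-- A test function as an element of the Hilbert space. -/
def testToL2 : 𝓓(halfLine, C2) →ₗ[ℂ] HSpace where
  toFun g := (memLp_testFunction g).toLp g
  map_add' _ _ := rfl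
  map_smul' _ _ := rfl

lemma testToL2_injective : Function.Injective testToL2 := by
  intro g₁ g₂ h
  have hae := (MemLp.toLp_eq_toLp_iff (memLp_testFunction g₁) (memLp_testFunction g₂)).1 h
  have heq := Measure.eqOn_open_of_ae_eq hae isOpen_Ioi g₁.continuous.continuousOn
    g₂.continuous.continuousOn
  have hzero (g : 𝓓(halfLine, C2)) {x : ℝ} (hx : x ∉ Ioi (0 : ℝ)) : g x = 0 :=
    image_eq_zero_of_notMem_tsupport fun h => hx (g.tsupport_subset h)
  ext1 x
  by_cases hx : x ∈ Ioi (0 : ℝ)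
  · exact heq hx
  · rw [hzero g₁ hx, hzero g₂ hx]

/-- The Dirac expression applied to a test function, as an element of the Hilbert space. -/
def diracToL2 (h : p.IsSubextremal ∨ p.IsExtremal) (k : ℤ) (amp : ℝ) :
    𝓓(halfLine, C2) →ₗ[ℂ] HSpace where
  toFun g := (memLp_diracExpr h k amp g).toLp (p.diracExpr k amp g)
  map_add' g₁ g₂ := by
    rw [← MemLp.toLp_add]
    exact MemLp.toLp_congr _ _ (by rw [diracExpr_add])
  map_smul' z g := by
    rw [RingHom.id_apply, ← MemLp.toLp_const_smul]
    exact MemLp.toLp_congr _ _ (by rw [diracExpr_smul])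

/-- The radial Dirac operator with anomalous magnetic moment of amplitude `amp`, as an unbounded
operator in `L²((0, ∞); ℂ²)` with domain `C_c^∞((0, ∞); ℂ²)`. -/
def diracOp (h : p.IsSubextremal ∨ p.IsExtremal) (k : ℤ) (amp : ℝ) : HSpace →ₗ.[ℂ] HSpace where
  domain := LinearMap.range testToL2
  toFun := diracToL2 h k amp ∘ₗ
    (LinearEquiv.ofInjective testToL2 testToL2_injective).symm.toLinearMap

lemma diracOp_apply (h : p.IsSubextremal ∨ p.IsExtremal) (k : ℤ) (amp : ℝ)
    (g : 𝓓(halfLine, C2)) :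
    diracOp h k amp ⟨testToL2 g, LinearMap.mem_range_self _ g⟩ = diracToL2 h k amp g :=
  congrArg (diracToL2 h k amp)
    ((LinearEquiv.ofInjective testToL2 testToL2_injective).symm_apply_apply g)

end RWNData

/-- A densely defined closable operator in a Hilbert space is essentially self-adjoint if its
closure is self-adjoint. -/
def IsEssentiallySelfAdjoint {H : Type*} [NormedAddCommGroup H] [InnerProductSpace ℂ H]
    [CompleteSpace H] (T : H →ₗ.[ℂ] H) : Prop :=
  Dense (T.domain : Set H) ∧ T.IsClosable ∧ IsSelfAdjoint T.closure

end

/-! The question reduces to the size of solutions at the singularity `x = 0`. A densely defined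
symmetric operator is essentially self-adjoint exactly when its adjoint is symmetric. The adjoint
here is the maximal operator: its elements `(y, z)` are locally absolutely continuous and it acts by
the Dirac expression. The defect of symmetry for two elements is therefore the difference of the
boundary values, at infinity and at zero, of `W = ȳ₁ z₂ - z̄₁ y₂` (Lagrange identity). Infinity
never contributes: `W` is a product of square integrable functions, hence integrable, and `W'` is
integrable, so `W` has a limit there and the limit is zero.

Near zero write `P = r₊ r₋`. Since `f² ~ P / r²`, one has `x ~ r³ / (3 P)`. Hence `a ± b` is `O(x ^
(-1/3))`, the angular term `k c` is `O(x ^ (-2/3))`, and the anomalous moment term is of order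
`1/x`: the off-diagonal potential is `q = -μ/x + O(x ^ (-2/3))` with `μ` = `singularExponent`. To
leading order the system decouples into `y' = -q y`, `z' = q z`, with solutions of size `x ^ μ` and
`x ^ (-μ)`. Both are square integrable at zero iff `|μ| < 1/2`. As `√P = √G m Z e / (ħ c)`, the mass
`M` and the charge number `Z` drop out of `μ`, and `|μ| ≥ 1/2` is the stated threshold.

To make this rigorous, a gauge `ψ = exp (-∫ q)`, comparable to `x ^ μ`, removes `q`: the derivatives
of `ψ z` and `ψ⁻¹ y` contain only the diagonal coefficients and the inhomogeneity. If `μ ≥ 1/2`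
(`solution_bounds`), `ψ z` has a limit at zero, square integrability of `z` forces that limit to
vanish, and the rate of convergence gives `z = O(x ^ (1/6))` with `y` bounded; hence `W → 0`. If `0
≤ μ < 1/2` (`exists_boundary_pair`), cut-off approximate solutions behaving like `(ψ, 0)` and `(·,
ψ⁻¹)` lie in the domain of the adjoint and have `W → 1` at zero. For negative `μ` the two components
exchange roles. -/

/-! ### Essential self-adjointness as symmetry of the adjoint -/

section HilbertSpace

variable {H : Type*} [NormedAddCommGroup H] [InnerProductSpace ℂ H]

/-- `(u, w)` belongs to the graph of the adjoint of `T`. -/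
def IsAdjointPair (T : H →ₗ.[ℂ] H) (u w : H) : Prop :=
  ∀ g : T.domain, inner ℂ (T g) u = inner ℂ (g : H) w

variable [CompleteSpace H] {T : H →ₗ.[ℂ] H}

lemma isAdjointPair_iff_mem_graph (hd : Dense (T.domain : Set H)) {u w : H} :
    IsAdjointPair T u w ↔ (u, w) ∈ T.adjoint.graph := by
  rw [LinearPMap.adjoint_graph_eq_graph_adjoint hd, Submodule.mem_adjoint_iff]
  constructor
  · intro h a b hab
    obtain ⟨y, hy, hy'⟩ := (LinearPMap.mem_graph_iff T).1 hab
    simp only at hy hy'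
    subst hy hy'
    rw [h y, sub_self]
  · intro h g
    exact sub_eq_zero.1 (h _ _ (T.mem_graph g))

/-- The closure of the graph of `T` consists of the pairs on which the boundary form of the adjoint
of `T` against all adjoint pairs vanishes. -/
lemma mem_topologicalClosure_graph {u w : H}
    (h : ∀ v k, IsAdjointPair T v k → inner ℂ w v = inner ℂ u k) :
    (u, w) ∈ T.graph.topologicalClosure := by
  -- `H × H` carries the sup norm; its `WithLp 2` copy is a Hilbert space with the same topology, in
  -- which a closure is a double orthogonal complement.
  set e := WithLp.linearEquiv 2 ℂ (H × H) with he
  set N : Submodule ℂ (WithLp 2 (H × H)) := T.graph.map e.symm.toLinearMap with hN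
  have hmem : e.symm (u, w) ∈ N.topologicalClosure := by
    rw [← Submodule.orthogonal_orthogonal_eq_closure, Submodule.mem_orthogonal]
    intro x hx
    rw [Submodule.mem_orthogonal] at hx
    -- Orthogonality of `(a, b)` to every `(g, T g)` reads `⟪T g, b⟫ = ⟪g, -a⟫`.
    have hpair : IsAdjointPair T (e x).2 (-(e x).1) := by
      intro g
      have := hx (e.symm ((g : H), T g)) (Submodule.mem_map_of_mem (T.mem_graph g))
      rw [WithLp.prod_inner_apply] at this
      simp only [inner_neg_right]
      rw [eq_neg_iff_add_eq_zero, add_comm]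
      exact this
    have h1 := h _ _ hpair
    rw [inner_neg_right] at h1
    have h2 : inner ℂ (e.symm (u, w)) x = 0 := by
      rw [WithLp.prod_inner_apply]
      change inner ℂ u (e x).1 + inner ℂ w (e x).2 = 0
      rw [h1, add_neg_cancel]
    exact inner_eq_zero_symm.1 h2
  rw [← SetLike.mem_coe, Submodule.topologicalClosure_coe] at hmem ⊢
  have hc : Continuous e := WithLp.prod_continuous_ofLp 2 H H
  have := map_mem_closure hc hmem (t := (T.graph : Set (H × H))) (by
    rintro _ ⟨y, hy, rfl⟩
    simpa using hy)
  simpa using this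

/-- A densely defined symmetric operator is essentially self-adjoint if and only if its adjoint is
symmetric. -/
theorem isEssentiallySelfAdjoint_iff (hd : Dense (T.domain : Set H)) (hs : T.IsFormalAdjoint T) :
    IsEssentiallySelfAdjoint T ↔
      ∀ u w v k, IsAdjointPair T u w → IsAdjointPair T v k → inner ℂ w v = inner ℂ u k := by
  have hle : T ≤ T.adjoint := hs.le_adjoint hd
  have hcl : T.IsClosable := (LinearPMap.adjoint_isClosed hd).isClosable.leIsClosable hle
  constructor
  · rintro ⟨-, -, hsa⟩ u w v k huw hvk
    -- The identity defining an adjoint pair is a closed condition on the graph, so it passes from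
    -- `T` to its closure.
    have hext (u w : H) (huw : IsAdjointPair T u w) : ∀ x ∈ T.closure.graph,
        inner ℂ x.2 u = inner ℂ x.1 w := by
      intro x hx
      rw [← hcl.graph_closure_eq_closure_graph, ← SetLike.mem_coe,
        Submodule.topologicalClosure_coe] at hx
      have hclosed : IsClosed {x : H × H | inner ℂ x.2 u = inner ℂ x.1 w} :=
        isClosed_eq (by fun_prop) (by fun_prop)
      refine closure_minimal ?_ hclosed hx
      intro y hy
      obtain ⟨g, hg, hg'⟩ := (LinearPMap.mem_graph_iff T).1 hy
      change inner ℂ y.2 u = inner ℂ y.1 w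
      rw [← hg, ← hg', huw g]
    -- Self-adjointness of the closure puts the first pair into its graph; the second pair can then
    -- be tested against it.
    have hmem : (u, w) ∈ T.closure.graph := by
      have h1 : IsAdjointPair T.closure u w :=
        fun g => hext u w huw _ (T.closure.mem_graph g)
      rw [isAdjointPair_iff_mem_graph hsa.dense_domain,
        LinearPMap.isSelfAdjoint_def.1 hsa] at h1
      exact h1
    exact hext v k hvk _ hmem
  · intro h
    have hgraph : T.graph.topologicalClosure = T.adjoint.graph := by
      apply le_antisymm
      · exact Submodule.topologicalClosure_minimal _ (LinearPMap.le_graph_of_le hle)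
          (LinearPMap.adjoint_isClosed hd)
      · rintro ⟨u, w⟩ hx
        exact mem_topologicalClosure_graph fun v k hvk =>
          h u w v k ((isAdjointPair_iff_mem_graph hd).2 hx) hvk
    have hcleq : T.closure = T.adjoint := by
      apply LinearPMap.eq_of_eq_graph
      rw [← hcl.graph_closure_eq_closure_graph, hgraph]
    have hd' : Dense (T.adjoint.domain : Set H) := hd.mono hle.1
    refine ⟨hd, hcl, ?_⟩
    rw [hcleq, LinearPMap.isSelfAdjoint_def]
    apply LinearPMap.eq_of_eq_graph
    -- Adjoints reverse inclusions, so `T ≤ T†` gives `T†† ≤ T†`. The opposite inclusion is the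
    -- symmetry of `T†`.
    apply le_antisymm
    · rintro ⟨u, w⟩ hx
      rw [← isAdjointPair_iff_mem_graph hd'] at hx
      rw [← isAdjointPair_iff_mem_graph hd]
      intro g
      obtain ⟨h1, h2⟩ := hle
      have := hx ⟨g, h1 g.2⟩
      rwa [← h2 (x := g) (y := ⟨g, h1 g.2⟩) rfl] at this
    · refine LinearPMap.le_graph_of_le (LinearPMap.IsFormalAdjoint.le_adjoint hd' ?_)
      intro u v
      exact h _ _ _ _ ((isAdjointPair_iff_mem_graph hd).2 (T.adjoint.mem_graph u))
        ((isAdjointPair_iff_mem_graph hd).2 (T.adjoint.mem_graph v))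

end HilbertSpace

/-! ### Primitives of locally integrable functions on the half line -/

/-- `U` is a primitive on `(0, ∞)` of the locally integrable function `h`. -/
structure IsPrimitive (U h : ℝ → ℂ) : Prop where
  intervalIntegrable : ∀ {a b : ℝ}, 0 < a → 0 < b → IntervalIntegrable h volume a b
  sub_eq : ∀ {a b : ℝ}, 0 < a → 0 < b → U b - U a = ∫ x in a..b, h x

lemma uIcc_subset_Ioi {a b : ℝ} (ha : 0 < a) (hb : 0 < b) : uIcc a b ⊆ Ioi 0 :=
  fun _ hx => lt_of_lt_of_le (lt_min ha hb) hx.1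

lemma AbsolutelyContinuousOnInterval.congr_uIcc {f g : ℝ → ℂ} {a b : ℝ}
    (hf : AbsolutelyContinuousOnInterval f a b) (hfg : ∀ x ∈ uIcc a b, f x = g x) :
    AbsolutelyContinuousOnInterval g a b := by
  rw [absolutelyContinuousOnInterval_iff] at hf ⊢
  intro ε hε
  obtain ⟨δ, hδ, h⟩ := hf ε hε
  refine ⟨δ, hδ, fun E hE hlt => ?_⟩
  rw [Finset.sum_congr rfl fun i hi => ?_]
  · exact h E hE hlt
  · rw [hfg _ (hE.1 i hi).1, hfg _ (hE.1 i hi).2]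

/-- The real and imaginary parts of the integral are absolutely continuous, and the integral is
their combination with the constants `1` and `I`. -/
lemma absolutelyContinuous_integral {h : ℝ → ℂ} {a b : ℝ} (hh : IntervalIntegrable h volume a b) :
    AbsolutelyContinuousOnInterval (fun x => ∫ t in a..x, h t) a b := by
  have hre : IntervalIntegrable (fun x => (h x).re) volume a b :=
    ⟨hh.1.re, hh.2.re⟩
  have him : IntervalIntegrable (fun x => (h x).im) volume a b :=
    ⟨hh.1.im, hh.2.im⟩
  have h1 := hre.absolutelyContinuousOnInterval_intervalIntegral (c := a) left_mem_uIcc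
  have h2 := him.absolutelyContinuousOnInterval_intervalIntegral (c := a) left_mem_uIcc
  have hc (z : ℂ) : AbsolutelyContinuousOnInterval (fun _ : ℝ => z) a b :=
    (LipschitzWith.const z).lipschitzOnWith.absolutelyContinuousOnInterval
  have h3 := (h1.fun_smul (hc 1)).fun_add (h2.fun_smul (hc Complex.I))
  refine h3.congr_uIcc fun x hx => ?_
  have hsub : uIcc a x ⊆ uIcc a b := uIcc_subset_uIcc_left hx
  rw [← intervalIntegral.integral_smul_const, ← intervalIntegral.integral_smul_const,
    ← intervalIntegral.integral_add]
  · refine intervalIntegral.integral_congr fun t _ => ?_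
    simp [Complex.re_add_im]
  · exact (hre.mono_set hsub).smul_continuousOn continuousOn_const
  · exact (him.mono_set hsub).smul_continuousOn continuousOn_const

namespace IsPrimitive

variable {U V h k : ℝ → ℂ}

lemma sub (hU : IsPrimitive U h) (hV : IsPrimitive V k) :
    IsPrimitive (fun x => U x - V x) (fun x => h x - k x) where
  intervalIntegrable ha hb := (hU.intervalIntegrable ha hb).sub (hV.intervalIntegrable ha hb)
  sub_eq ha hb := by
    rw [intervalIntegral.integral_sub (hU.intervalIntegrable ha hb) (hV.intervalIntegrable ha hb),
      ← hU.sub_eq ha hb, ← hV.sub_eq ha hb]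
    ring

lemma conj (hU : IsPrimitive U h) :
    IsPrimitive (fun x => starRingEnd ℂ (U x)) (fun x => starRingEnd ℂ (h x)) where
  intervalIntegrable ha hb := by
    have := hU.intervalIntegrable ha hb
    exact ⟨(Complex.conjCLE : ℂ →L[ℝ] ℂ).integrable_comp this.1,
      (Complex.conjCLE : ℂ →L[ℝ] ℂ).integrable_comp this.2⟩
  sub_eq ha hb := by
    rw [← map_sub, hU.sub_eq ha hb]
    simp [intervalIntegral, integral_conj]

lemma congr_right (hU : IsPrimitive U h) (hhk : ∀ x, 0 < x → h x = k x) : IsPrimitive U k where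
  intervalIntegrable {a b} ha hb := (hU.intervalIntegrable ha hb).congr fun x hx =>
    hhk x (uIcc_subset_Ioi ha hb (uIoc_subset_uIcc hx))
  sub_eq ha hb := by
    rw [hU.sub_eq ha hb]
    exact intervalIntegral.integral_congr fun x hx => hhk x (uIcc_subset_Ioi ha hb hx)

lemma congr_ae (hU : IsPrimitive U h) (hhk : ∀ᵐ x, 0 < x → h x = k x) : IsPrimitive U k where
  intervalIntegrable {a b} ha hb := (hU.intervalIntegrable ha hb).congr_ae <| by
    rw [EventuallyEq, ae_restrict_iff' measurableSet_uIoc]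
    filter_upwards [hhk] with x hx hxm
    exact hx (uIcc_subset_Ioi ha hb (uIoc_subset_uIcc hxm))
  sub_eq ha hb := by
    rw [hU.sub_eq ha hb]
    refine intervalIntegral.integral_congr_ae ?_
    filter_upwards [hhk] with x hx hxm
    exact hx (uIcc_subset_Ioi ha hb (uIoc_subset_uIcc hxm))

lemma of_hasDerivAt (hd : ∀ x, 0 < x → HasDerivAt U (h x) x) (hc : ContinuousOn h (Ioi 0)) :
    IsPrimitive U h where
  intervalIntegrable ha hb := (hc.mono (uIcc_subset_Ioi ha hb)).intervalIntegrable
  sub_eq ha hb := (intervalIntegral.integral_eq_sub_of_hasDerivAt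
    (fun x hx => hd x (uIcc_subset_Ioi ha hb hx))
    (hc.mono (uIcc_subset_Ioi ha hb)).intervalIntegrable).symm

lemma of_integral (hi : ∀ {a b : ℝ}, 0 < a → 0 < b → IntervalIntegrable h volume a b) :
    IsPrimitive (fun x => ∫ t in (1 : ℝ)..x, h t) h where
  intervalIntegrable := hi
  sub_eq ha hb := intervalIntegral.integral_interval_sub_left (hi one_pos hb) (hi one_pos ha)

lemma eqOn (hU : IsPrimitive U h) {a x : ℝ} (ha : 0 < a) (hx : 0 < x) :
    U x = U a + ∫ t in a..x, h t := by
  rw [← hU.sub_eq ha hx]; ring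

lemma absolutelyContinuousOnInterval (hU : IsPrimitive U h) {a b : ℝ} (ha : 0 < a) (hb : 0 < b) :
    AbsolutelyContinuousOnInterval U a b := by
  have hc : AbsolutelyContinuousOnInterval (fun _ : ℝ => U a) a b :=
    (LipschitzWith.const _).lipschitzOnWith.absolutelyContinuousOnInterval
  exact (hc.fun_add (absolutelyContinuous_integral (hU.intervalIntegrable ha hb))).congr_uIcc
    fun x hx => (hU.eqOn ha (uIcc_subset_Ioi ha hb hx)).symm

lemma continuousOn (hU : IsPrimitive U h) : ContinuousOn U (Ioi 0) := by
  intro x hx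
  have hx : 0 < x := hx
  have := (hU.absolutelyContinuousOnInterval (half_pos hx) (by linarith : 0 < x + 1)).continuousOn
  rw [uIcc_of_le (by linarith)] at this
  exact (this.continuousAt (Icc_mem_nhds (by linarith) (by linarith))).continuousWithinAt

lemma ae_hasDerivAt (hU : IsPrimitive U h) {a b : ℝ} (ha : 0 < a) (hb : 0 < b) :
    ∀ᵐ x, x ∈ uIcc a b → HasDerivAt U (h x) x := by
  have hpos : ∀ x ∈ uIcc a b, 0 < x := fun x hx => uIcc_subset_Ioi ha hb hx
  filter_upwards [(hU.intervalIntegrable ha hb).ae_hasDerivAt_integral] with x hx hxm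
  refine ((hx hxm a left_mem_uIcc).const_add (U a)).congr_of_eventuallyEq ?_
  filter_upwards [isOpen_Ioi.mem_nhds (hpos x hxm)] with y hy
  exact hU.eqOn ha hy

/-- The product rule. -/
lemma mul (hU : IsPrimitive U h) (hV : IsPrimitive V k) :
    IsPrimitive (fun x => U x * V x) (fun x => h x * V x + U x * k x) := by
  have hi : ∀ {a b : ℝ}, 0 < a → 0 < b →
      IntervalIntegrable (fun x => h x * V x + U x * k x) volume a b := fun ha hb =>
    ((hU.intervalIntegrable ha hb).mul_continuousOn
      (hV.continuousOn.mono (uIcc_subset_Ioi ha hb))).add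
    ((hV.intervalIntegrable ha hb).continuousOn_mul
      (hU.continuousOn.mono (uIcc_subset_Ioi ha hb)))
  refine ⟨hi, fun {a b} ha hb => ?_⟩
  -- `U V` minus the integral of the candidate derivative is absolutely continuous with derivative
  -- zero almost everywhere, hence constant.
  have hac := ((hU.absolutelyContinuousOnInterval ha hb).fun_smul
    (hV.absolutelyContinuousOnInterval ha hb)).fun_sub (absolutelyContinuous_integral (hi ha hb))
  obtain ⟨C, hC⟩ := hac.const_of_ae_hasDerivAt_zero (by
    filter_upwards [hU.ae_hasDerivAt ha hb, hV.ae_hasDerivAt ha hb,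
      (hi ha hb).ae_hasDerivAt_integral] with x h1 h2 h3 hx
    have := ((h1 hx).mul (h2 hx)).sub (h3 hx a left_mem_uIcc)
    simp only [sub_self] at this
    exact this)
  have h1 := hC a left_mem_uIcc
  have h2 := hC b right_mem_uIcc
  simp only [smul_eq_mul, intervalIntegral.integral_same, sub_zero] at h1 h2
  rw [h1, ← h2]
  ring

end IsPrimitive

lemma exists_Icc_of_isCompact_subset_Ioi {K : Set ℝ} (hK : IsCompact K) (h0 : K ⊆ Ioi 0) :
    ∃ a b : ℝ, 0 < a ∧ a ≤ b ∧ K ⊆ Icc a b := by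
  rcases K.eq_empty_or_nonempty with rfl | hne
  · exact ⟨1, 1, one_pos, le_rfl, empty_subset _⟩
  · refine ⟨sInf K, sSup K, h0 (hK.sInf_mem hne), ?_, fun x hx =>
      ⟨csInf_le hK.bddBelow hx, le_csSup hK.bddAbove hx⟩⟩
    exact Real.sInf_le_sSup K hK.bddBelow hK.bddAbove

lemma integral_eq_intervalIntegral_of_support {E : Type*} [NormedAddCommGroup E] [NormedSpace ℝ E]
    {f : ℝ → E} {a b : ℝ} (hab : a ≤ b) (hf : ∀ x, x ∉ Icc a b → f x = 0) :
    ∫ x, f x = ∫ x in a..b, f x := by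
  rw [intervalIntegral.integral_of_le hab, ← integral_Icc_eq_integral_Ioc,
    setIntegral_eq_integral_of_forall_compl_eq_zero hf]

/-- The derivative of a function of compact support in `(0, ∞)` has vanishing integral. -/
lemma IsPrimitive.integral_eq_zero {U h : ℝ → ℂ} (hU : IsPrimitive U h) {K : Set ℝ}
    (hK : IsCompact K) (h0 : K ⊆ Ioi 0) (hU0 : ∀ x, x ∉ K → U x = 0) (hh0 : ∀ x, x ∉ K → h x = 0) :
    ∫ x, h x = 0 := by
  obtain ⟨a, b, ha, hab, hKab⟩ := exists_Icc_of_isCompact_subset_Ioi hK h0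
  have ha2 : 0 < a / 2 := half_pos ha
  -- The interval is enlarged so that both endpoints lie outside `K`, where `U` vanishes.
  rw [integral_eq_intervalIntegral_of_support (a := a / 2) (b := b + 1) (by linarith),
    ← hU.sub_eq ha2 (by linarith), hU0, hU0, sub_zero]
  · exact fun hx => absurd (hKab hx).1 (by linarith)
  · exact fun hx => absurd (hKab hx).2 (by linarith)
  · intro x hx
    exact hh0 x fun hxK => hx ⟨by linarith [(hKab hxK).1], by linarith [(hKab hxK).2]⟩

/-! ### Weak derivatives on the half line -/

lemma integrable_smul_of_hasCompactSupport {w : ℝ → ℂ} (hw : LocallyIntegrableOn w (Ioi 0))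
    {γ : ℝ → ℝ} (hγ : Continuous γ) (hγc : HasCompactSupport γ) (hγs : tsupport γ ⊆ Ioi 0) :
    Integrable (fun x => γ x • w x) := by
  have h1 := (hw.integrableOn_compact_subset hγs hγc.isCompact).continuousOn_smul
    hγ.continuousOn hγc.isCompact
  refine (integrableOn_iff_integrable_of_support_subset ?_).1 h1
  exact (Function.support_smul_subset_left γ w).trans (subset_tsupport γ)

/-- A locally integrable function with vanishing weak derivative is constant. -/
lemma ae_eq_const_of_integral_deriv_smul_eq_zero {w : ℝ → ℂ} (hw : LocallyIntegrableOn w (Ioi 0))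
    (h : ∀ γ : ℝ → ℝ, ContDiff ℝ ∞ γ → HasCompactSupport γ → tsupport γ ⊆ Ioi 0 →
      ∫ x, deriv γ x • w x = 0) :
    ∃ c : ℂ, ∀ᵐ x, x ∈ Ioi (0 : ℝ) → w x = c := by
  -- Any bump of mass one in `(0, ∞)` serves; this one is supported in `[1, 3]`. The constant is the
  -- mean of `w` against it.
  let η : ContDiffBump (2 : ℝ) := ⟨1 / 2, 1, by norm_num, by norm_num⟩
  set ρ : ℝ → ℝ := η.normed volume with hρ
  have hρsm : ContDiff ℝ ∞ ρ := η.contDiff_normed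
  have hρc : HasCompactSupport ρ := η.hasCompactSupport_normed
  have hρs : tsupport ρ ⊆ Ioi 0 := by
    rw [hρ, η.tsupport_normed_eq, Real.closedBall_eq_Icc]
    intro x hx
    have : (2 : ℝ) - 1 ≤ x := hx.1
    exact lt_of_lt_of_le (by norm_num) this
  have hρi : ∫ x, ρ x = 1 := η.integral_normed
  have hint (γ : ℝ → ℝ) (hγ : Continuous γ) (hγc : HasCompactSupport γ) (hγs : tsupport γ ⊆ Ioi 0) :
      Integrable (fun x => γ x • w x) :=
    integrable_smul_of_hasCompactSupport hw hγ hγc hγs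
  refine ⟨∫ x, ρ x • w x, ?_⟩
  set c := ∫ x, ρ x • w x with hc
  have key := isOpen_Ioi.ae_eq_zero_of_integral_contDiff_smul_eq_zero (f := fun x => w x - c)
    (U := Ioi (0 : ℝ)) (μ := volume) (hw.sub (locallyIntegrableOn_const c)) ?_
  · filter_upwards [key] with x hx hx0 using sub_eq_zero.1 (hx hx0)
  intro γ hγ hγc hγs
  set m := ∫ x, γ x with hm
  -- Subtracting the mass of `γ` makes the integral zero, so the primitive `Θ` of `θ` again has
  -- compact support and is an admissible test function.
  set θ : ℝ → ℝ := fun x => γ x - m * ρ x with hθ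
  have hθsm : ContDiff ℝ ∞ θ := hγ.sub (contDiff_const.mul hρsm)
  obtain ⟨a, b, ha, hab, hKab⟩ := exists_Icc_of_isCompact_subset_Ioi
    (hγc.isCompact.union hρc.isCompact) (union_subset hγs hρs)
  have hθ0 (x : ℝ) (hx : x ∉ Icc a b) : θ x = 0 := by
    have h1 : γ x = 0 := image_eq_zero_of_notMem_tsupport fun h => hx (hKab (Or.inl h))
    have h2 : ρ x = 0 := image_eq_zero_of_notMem_tsupport fun h => hx (hKab (Or.inr h))
    simp [hθ, h1, h2]
  have hθi : ∫ x in a..b, θ x = 0 := by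
    rw [← integral_eq_intervalIntegral_of_support hab hθ0, hθ, integral_sub
      (hγ.continuous.integrable_of_hasCompactSupport hγc)
      ((hρsm.continuous.integrable_of_hasCompactSupport hρc).const_mul m), integral_const_mul, hρi]
    simp [hm]
  set Θ : ℝ → ℝ := fun x => ∫ t in a..x, θ t with hΘ
  have hΘd (x : ℝ) : HasDerivAt Θ (θ x) x :=
    intervalIntegral.integral_hasDerivAt_right (hθsm.continuous.intervalIntegrable _ _)
      hθsm.continuous.stronglyMeasurable.stronglyMeasurableAtFilter hθsm.continuous.continuousAt
  have hΘderiv : deriv Θ = θ := funext fun x => (hΘd x).deriv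
  have hΘsm : ContDiff ℝ ∞ Θ := by
    rw [contDiff_infty_iff_deriv, hΘderiv]
    exact ⟨fun x => (hΘd x).differentiableAt, hθsm⟩
  have hΘ0 (x : ℝ) (hx : x ∉ Icc a b) : Θ x = 0 := by
    rw [mem_Icc, not_and_or, not_le, not_le] at hx
    rcases hx with hx | hx
    · rw [hΘ]
      dsimp only
      rw [intervalIntegral.integral_symm, neg_eq_zero]
      rw [intervalIntegral.integral_of_le hx.le, integral_Ioc_eq_integral_Ioo]
      refine setIntegral_eq_zero_of_forall_eq_zero fun t ht => hθ0 t fun h => ?_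
      exact absurd h.1 (not_le.2 ht.2)
    · have hI (u v : ℝ) : IntervalIntegrable θ volume u v := hθsm.continuous.intervalIntegrable _ _
      rw [hΘ]
      dsimp only
      rw [← intervalIntegral.integral_add_adjacent_intervals (hI a b) (hI b x), hθi, zero_add]
      rw [intervalIntegral.integral_of_le hx.le]
      refine setIntegral_eq_zero_of_forall_eq_zero fun t ht => hθ0 t fun h => ?_
      exact absurd h.2 (not_le.2 ht.1)
  have hΘs : tsupport Θ ⊆ Icc a b := by
    refine closure_minimal (fun x hx => ?_) isClosed_Icc
    by_contra hx'
    exact hx (hΘ0 x hx')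
  have h1 := h Θ hΘsm (HasCompactSupport.intro isCompact_Icc hΘ0)
    (hΘs.trans fun x hx => lt_of_lt_of_le ha hx.1)
  rw [hΘderiv] at h1
  have h2 : (fun x => θ x • w x) = fun x => γ x • w x - (m : ℂ) * (ρ x • w x) := by
    funext x
    simp only [hθ, Complex.real_smul]
    push_cast
    ring
  rw [h2, integral_sub (hint γ hγ.continuous hγc hγs)
    ((hint ρ hρsm.continuous hρc hρs).const_mul _), integral_const_mul, ← hc] at h1
  have h3 : (fun x => γ x • (w x - c)) = fun x => γ x • w x - (γ x : ℂ) * c := by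
    funext x
    simp only [Complex.real_smul]
    ring
  have h4 : Integrable (fun x => (γ x : ℂ) * c) :=
    (hγ.continuous.integrable_of_hasCompactSupport hγc).ofReal.mul_const c
  rw [h3, integral_sub (hint γ hγ.continuous hγc hγs) h4, integral_mul_const,
    integral_complex_ofReal, ← hm, h1]

/-- A function with locally integrable weak derivative is a.e. equal to a primitive of it. -/
lemma exists_isPrimitive_of_weak {u h : ℝ → ℂ} (hu : LocallyIntegrableOn u (Ioi 0))
    (hh : LocallyIntegrableOn h (Ioi 0))
    (hw : ∀ γ : ℝ → ℝ, ContDiff ℝ ∞ γ → HasCompactSupport γ → tsupport γ ⊆ Ioi 0 →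
      ∫ x, deriv γ x • u x = - ∫ x, γ x • h x) :
    ∃ U, IsPrimitive U h ∧ ∀ᵐ x, 0 < x → u x = U x := by
  have hi : ∀ {a b : ℝ}, 0 < a → 0 < b → IntervalIntegrable h volume a b := fun ha hb => by
    rw [intervalIntegrable_iff']
    exact hh.integrableOn_compact_subset (uIcc_subset_Ioi ha hb) isCompact_uIcc
  have hU := IsPrimitive.of_integral hi
  set U := fun x => ∫ t in (1 : ℝ)..x, h t with hUdef
  have hUloc : LocallyIntegrableOn U (Ioi 0) :=
    hU.continuousOn.locallyIntegrableOn measurableSet_Ioi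
  obtain ⟨c, hc⟩ := ae_eq_const_of_integral_deriv_smul_eq_zero (hu.sub hUloc) fun γ hγ hγc hγs => by
    have hγ' : Continuous (deriv γ) := hγ.continuous_deriv (by simp)
    have hγp : IsPrimitive (fun x => (γ x : ℂ)) (fun x => ((deriv γ x : ℝ) : ℂ)) :=
      IsPrimitive.of_hasDerivAt
        (fun x _ => ((hγ.differentiable (by simp)) x).hasDerivAt.ofReal_comp)
        (Complex.continuous_ofReal.comp hγ').continuousOn
    have hz : ∀ x, x ∉ tsupport γ → γ x = 0 := fun x hx => image_eq_zero_of_notMem_tsupport hx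
    have hz' : ∀ x, x ∉ tsupport γ → deriv γ x = 0 := fun x hx =>
      image_eq_zero_of_notMem_tsupport fun h => hx (tsupport_deriv_subset h)
    -- The integral of `(γ U)'` vanishes, so `U` has the same weak derivative as `u` and the two
    -- differ by a constant.
    have h0 := (hγp.mul hU).integral_eq_zero hγc.isCompact hγs
      (fun x hx => by simp [hz x hx]) (fun x hx => by simp [hz x hx, hz' x hx])
    have i1 := integrable_smul_of_hasCompactSupport hUloc hγ' hγc.deriv
      ((tsupport_deriv_subset).trans hγs)
    have i2 := integrable_smul_of_hasCompactSupport hh hγ.continuous hγc hγs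
    have i3 := integrable_smul_of_hasCompactSupport hu hγ' hγc.deriv
      ((tsupport_deriv_subset).trans hγs)
    have h1 : ∫ x, deriv γ x • U x = - ∫ x, γ x • h x := by
      simp only [← Complex.real_smul] at h0
      rw [integral_add i1 i2] at h0
      exact eq_neg_of_add_eq_zero_left h0
    simp only [Pi.sub_apply, smul_sub]
    rw [integral_sub i3 i1, hw γ hγ hγc hγs, h1, sub_self]
  refine ⟨fun x => U x + c, ⟨hi, fun ha hb => ?_⟩, ?_⟩
  · rw [← hU.sub_eq ha hb]; ring
  · filter_upwards [hc] with x hx hx0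
    rw [← hx hx0, Pi.sub_apply]
    ring

/-! ### The leading behaviour at the singularity -/

/-- A positive solution of `ψ' = -q ψ` where `q ∼ -μ/x` at zero; it behaves like `x ^ μ`. -/
structure IsGauge (q : ℝ → ℝ) (μ : ℝ) (ψ : ℝ → ℝ) (K : ℝ) : Prop where
  pos : ∀ {x}, 0 < x → 0 < ψ x
  hasDerivAt : ∀ {x}, 0 < x → HasDerivAt ψ (-(q x) * ψ x) x
  const_pos : 0 < K
  le : ∀ {x}, 0 < x → x ≤ 1 → ψ x ≤ K * x ^ μ
  inv_le : ∀ {x}, 0 < x → x ≤ 1 → (ψ x)⁻¹ ≤ K * x ^ (-μ)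

lemma integral_rpow_le {p x y : ℝ} (hp : -1 < p) (hx : 0 < x) (hxy : x ≤ y) (hy : y ≤ 1) :
    ∫ s in x..y, s ^ p ≤ 1 / (p + 1) := by
  rw [integral_rpow (Or.inl hp)]
  have h0 : 0 < p + 1 := by linarith
  have h1 : 0 ≤ x ^ (p + 1) := Real.rpow_nonneg hx.le _
  have h2 : y ^ (p + 1) ≤ 1 := Real.rpow_le_one (by linarith) hy h0.le
  gcongr
  linarith

/-- Take `ψ = exp (-∫₁ˣ q)`. The error `q + μ/x` is integrable at zero, so the exponent differs from
`μ log x` by at most `3 C`, where `3 = ∫₀¹ s ^ (-2/3)`; hence `K = exp (3 C)`. -/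
lemma exists_isGauge {q : ℝ → ℝ} (hq : ContinuousOn q (Ioi 0)) {μ C : ℝ}
    (hC : ∀ x, 0 < x → x ≤ 1 → |q x + μ / x| ≤ C * x ^ (-(2 / 3) : ℝ)) :
    ∃ ψ K, IsGauge q μ ψ K := by
  have hqi {a b : ℝ} (ha : 0 < a) (hb : 0 < b) : IntervalIntegrable q volume a b :=
    (hq.mono (uIcc_subset_Ioi ha hb)).intervalIntegrable
  have hder (x : ℝ) (hx : 0 < x) : HasDerivAt (fun x => ∫ s in (1 : ℝ)..x, q s) (q x) x :=
    intervalIntegral.integral_hasDerivAt_right (hqi one_pos hx)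
      (hq.stronglyMeasurableAtFilter isOpen_Ioi x hx) (hq.continuousAt (isOpen_Ioi.mem_nhds hx))
  have hC0 : 0 ≤ C := by
    have := (abs_nonneg _).trans (hC 1 one_pos le_rfl)
    simpa using this
  have hbound (x : ℝ) (hx : 0 < x) (hx1 : x ≤ 1) :
      |-(∫ s in (1 : ℝ)..x, q s) - μ * Real.log x| ≤ C * 3 := by
    have h1 : -(∫ s in (1 : ℝ)..x, q s) - μ * Real.log x = ∫ s in x..1, (q s + μ / s) := by
      have hi : IntervalIntegrable (fun s : ℝ => μ / s) volume x 1 := by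
        refine ContinuousOn.intervalIntegrable fun s hs => ?_
        have : s ≠ 0 := (uIcc_subset_Ioi hx one_pos hs).ne'
        exact ContinuousAt.continuousWithinAt (by fun_prop (disch := assumption))
      rw [intervalIntegral.integral_add (hqi hx one_pos) hi, intervalIntegral.integral_symm]
      have : ∫ s in x..1, μ / s = μ * ∫ s in x..1, s⁻¹ := by
        rw [← intervalIntegral.integral_const_mul]; rfl
      rw [this, integral_inv_of_pos hx one_pos, one_div, Real.log_inv]
      ring
    rw [h1, ← Real.norm_eq_abs]
    have hi : IntervalIntegrable (fun s : ℝ => C * s ^ (-(2 / 3) : ℝ)) volume x 1 :=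
      (intervalIntegral.intervalIntegrable_rpow' (by norm_num)).const_mul C
    refine (intervalIntegral.norm_integral_le_of_norm_le hx1
      (Eventually.of_forall fun s hs => hC s (hx.trans hs.1) hs.2) hi).trans ?_
    rw [intervalIntegral.integral_const_mul]
    gcongr
    refine (integral_rpow_le (by norm_num) hx hx1 le_rfl).trans ?_
    norm_num
  refine ⟨fun x => Real.exp (-∫ s in (1 : ℝ)..x, q s), Real.exp (C * 3), fun _ => Real.exp_pos _,
    fun {x} hx => ?_, Real.exp_pos _, fun {x} hx hx1 => ?_, fun {x} hx hx1 => ?_⟩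
  · have := ((hder x hx).neg).exp
    rwa [mul_comm] at this
  · rw [Real.rpow_def_of_pos hx, ← Real.exp_add, Real.exp_le_exp]
    linarith [(abs_le.1 (hbound x hx hx1)).2]
  · rw [Real.rpow_def_of_pos hx, ← Real.exp_add, ← Real.exp_neg, Real.exp_le_exp]
    linarith [(abs_le.1 (hbound x hx hx1)).1]

/-- The components `y` and `z` carry `-q` and `q`, so the inverse gauge does for one what the gauge
does for the other. -/
lemma IsGauge.inv {q ψ : ℝ → ℝ} {μ K : ℝ} (h : IsGauge q μ ψ K) :
    IsGauge (fun x => -q x) (-μ) (fun x => (ψ x)⁻¹) K where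
  pos hx := inv_pos.2 (h.pos hx)
  hasDerivAt hx := by
    have hne := (h.pos hx).ne'
    have := (h.hasDerivAt hx).fun_inv hne
    rwa [show -(-(q _) * ψ _) / ψ _ ^ 2 = -(-q _) * (ψ _)⁻¹ by field_simp] at this
  const_pos := h.const_pos
  le := h.inv_le
  inv_le hx hx1 := by simpa using h.le hx hx1

lemma IsGauge.continuousOn {q ψ : ℝ → ℝ} {μ K : ℝ} (h : IsGauge q μ ψ K) :
    ContinuousOn ψ (Ioi 0) :=
  fun _ hx => (h.hasDerivAt hx).continuousAt.continuousWithinAt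

lemma IsGauge.isPrimitive {q ψ : ℝ → ℝ} {μ K : ℝ} (h : IsGauge q μ ψ K)
    (hq : ContinuousOn q (Ioi 0)) :
    IsPrimitive (fun x => (ψ x : ℂ)) (fun x => -(q x : ℂ) * (ψ x : ℂ)) := by
  refine IsPrimitive.of_hasDerivAt (fun x hx => ?_) ?_
  · have := (h.hasDerivAt hx).ofReal_comp
    push_cast at this
    exact this
  · exact (Complex.continuous_ofReal.comp_continuousOn hq).neg.mul
      (Complex.continuous_ofReal.comp_continuousOn h.continuousOn)

/-- A function whose derivative is bounded by `x ^ p` times a square integrable function has a limit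
at zero, which is attained at the rate `x ^ (p + 1/2)`. -/
lemma IsPrimitive.exists_limit_at_zero {w h : ℝ → ℂ} (hw : IsPrimitive w h) {p C : ℝ} (hp : 0 ≤ p)
    {g : ℝ → ℝ} (hg : IntegrableOn (fun x => g x ^ 2) (Ioc 0 1))
    (hC : 0 ≤ C) (hle : ∀ x, 0 < x → x ≤ 1 → ‖h x‖ ≤ C * x ^ p * g x) :
    ∃ ℓ K, 0 ≤ K ∧ ∀ x, 0 < x → x ≤ 1 → ‖w x - ℓ‖ ≤ K * x ^ (p + 1 / 2) := by
  set S := ∫ x in Ioc (0 : ℝ) 1, g x ^ 2 with hS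
  have hS0 : 0 ≤ S := setIntegral_nonneg measurableSet_Ioc fun x _ => sq_nonneg _
  set K := C / 2 * (S + 1) with hK
  have hK0 : 0 ≤ K := by positivity
  have hdiff : ∀ a b : ℝ, 0 < a → a ≤ b → b ≤ 1 → ‖w b - w a‖ ≤ K * b ^ (p + 1 / 2) := by
    intro a b ha hab hb1
    have hb : 0 < b := ha.trans_le hab
    have hsub : Ioc a b ⊆ Ioc 0 1 := Ioc_subset_Ioc ha.le hb1
    have hgi : IntervalIntegrable (fun x => g x ^ 2) volume a b :=
      (intervalIntegrable_iff_integrableOn_Ioc_of_le hab).2 (hg.mono_set hsub)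
    rw [hw.sub_eq ha hb]
    have hr : b ^ (1 / 2 : ℝ) * b ^ (-(1 / 2) : ℝ) = 1 := by
      rw [← Real.rpow_add hb]; norm_num
    have hr' : b ^ (-(1 / 2) : ℝ) * b = b ^ (1 / 2 : ℝ) := by
      nth_rw 2 [← Real.rpow_one b]
      rw [← Real.rpow_add hb]; norm_num
    have hptw : ∀ x ∈ Ioc a b, ‖h x‖ ≤ C / 2 * b ^ p *
        (b ^ (1 / 2 : ℝ) * g x ^ 2 + b ^ (-(1 / 2) : ℝ)) := by
      intro x hx
      have hx0 : 0 < x := ha.trans hx.1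
      have h1 := hle x hx0 (hx.2.trans hb1)
      have h2 : x ^ p ≤ b ^ p := Real.rpow_le_rpow hx0.le hx.2 hp
      have h4 : 0 < b ^ (1 / 2 : ℝ) := Real.rpow_pos_of_pos hb _
      have h5 : 0 < b ^ (-(1 / 2) : ℝ) := Real.rpow_pos_of_pos hb _
      -- Young's inequality, weighted so that integration over an interval of length at most `b`
      -- turns both terms into multiples of `b ^ (1/2)`.
      have h3 : 2 * |g x| ≤ b ^ (1 / 2 : ℝ) * g x ^ 2 + b ^ (-(1 / 2) : ℝ) := by
        have h6 : 0 ≤ b ^ (-(1 / 2) : ℝ) * (b ^ (1 / 2 : ℝ) * |g x| - 1) ^ 2 := by positivity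
        have h7 : b ^ (-(1 / 2) : ℝ) * (b ^ (1 / 2 : ℝ) * |g x| - 1) ^ 2 =
          (b ^ (1 / 2 : ℝ) * b ^ (-(1 / 2) : ℝ)) * (b ^ (1 / 2 : ℝ) * |g x| ^ 2)
            - 2 * (b ^ (1 / 2 : ℝ) * b ^ (-(1 / 2) : ℝ)) * |g x| + b ^ (-(1 / 2) : ℝ) := by ring
        rw [h7, hr, sq_abs] at h6
        linarith
      have h8 : 0 ≤ x ^ p := Real.rpow_nonneg hx0.le _
      calc ‖h x‖ ≤ C * x ^ p * g x := h1
        _ ≤ C * x ^ p * |g x| := by gcongr; exact le_abs_self _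
        _ ≤ C * b ^ p * |g x| := by gcongr
        _ = C / 2 * b ^ p * (2 * |g x|) := by ring
        _ ≤ _ := by gcongr
    refine (intervalIntegral.norm_integral_le_of_norm_le hab
      (Eventually.of_forall hptw)
      (((hgi.const_mul _).add intervalIntegrable_const).const_mul _)).trans ?_
    rw [intervalIntegral.integral_const_mul, intervalIntegral.integral_add (hgi.const_mul _)
      intervalIntegrable_const, intervalIntegral.integral_const_mul, intervalIntegral.integral_const,
      smul_eq_mul]
    have hI : ∫ x in a..b, g x ^ 2 ≤ S := by
      rw [intervalIntegral.integral_of_le hab]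
      exact setIntegral_mono_set hg (Eventually.of_forall fun x => sq_nonneg _)
        hsub.eventuallyLE
    have hb' : (b - a) * b ^ (-(1 / 2) : ℝ) ≤ b ^ (1 / 2 : ℝ) := by
      rw [← hr', mul_comm]
      gcongr
      linarith
    calc C / 2 * b ^ p * (b ^ (1 / 2 : ℝ) * (∫ x in a..b, g x ^ 2) + (b - a) * b ^ (-(1 / 2) : ℝ))
        ≤ C / 2 * b ^ p * (b ^ (1 / 2 : ℝ) * S + b ^ (1 / 2 : ℝ)) := by gcongr
      _ = K * b ^ (p + 1 / 2) := by rw [Real.rpow_add hb, hK]; ring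
  have htend : Tendsto (fun b : ℝ => K * b ^ (p + 1 / 2)) (𝓝[>] 0) (𝓝 0) := by
    have : Tendsto (fun b : ℝ => K * b ^ (p + 1 / 2)) (𝓝 0) (𝓝 (K * (0 : ℝ) ^ (p + 1 / 2))) :=
      ((Real.continuousAt_rpow_const _ _ (Or.inr (by positivity))).tendsto).const_mul K
    rw [Real.zero_rpow (by positivity), mul_zero] at this
    exact this.mono_left nhdsWithin_le_nhds
  have hcauchy : Cauchy (map w (𝓝[>] 0)) := by
    rw [Metric.cauchy_iff]
    refine ⟨inferInstance, fun ε hε => ?_⟩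
    obtain ⟨δ, ⟨hδ, hδ1⟩⟩ := ((htend.eventually (gt_mem_nhds hε)).and
      (Ioc_mem_nhdsGT (zero_lt_one' ℝ))).exists
    refine ⟨w '' Ioc 0 δ, image_mem_map (Ioc_mem_nhdsGT hδ1.1), ?_⟩
    have hsym : ∀ a b : ℝ, a ∈ Ioc 0 δ → b ∈ Ioc 0 δ → a ≤ b → dist (w b) (w a) < ε := by
      intro a b ha hb hab
      rw [dist_eq_norm]
      refine (hdiff a b ha.1 hab (hb.2.trans hδ1.2)).trans_lt (lt_of_le_of_lt ?_ hδ)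
      gcongr
      · exact hb.1.le
      · exact hb.2
    rintro _ ⟨a, ha, rfl⟩ _ ⟨b, hb, rfl⟩
    rcases le_total a b with hab | hab
    · rw [dist_comm]; exact hsym a b ha hb hab
    · exact hsym b a hb ha hab
  obtain ⟨ℓ, hℓ⟩ := CompleteSpace.complete hcauchy
  have hℓ : Tendsto w (𝓝[>] 0) (𝓝 ℓ) := hℓ
  refine ⟨ℓ, K, hK0, fun x hx hx1 => ?_⟩
  refine le_of_tendsto ((tendsto_const_nhds.sub hℓ).norm) ?_
  filter_upwards [Ioc_mem_nhdsGT hx] with a ha using hdiff a x ha.1 ha.2 hx1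

lemma not_integrableOn_inv {c δ : ℝ} (hc : 0 < c) (hδ : 0 < δ) :
    ¬ IntegrableOn (fun x : ℝ => c * x⁻¹) (Ioc 0 δ) := by
  intro h
  have h1 : IntegrableOn (fun x : ℝ => x⁻¹) (Ioc 0 δ) := by
    have := h.const_mul c⁻¹
    rw [IntegrableOn]
    simpa [← mul_assoc, inv_mul_cancel₀ hc.ne'] using this
  rw [← intervalIntegrable_iff_integrableOn_Ioc_of_le hδ.le, intervalIntegrable_inv_iff] at h1
  rcases h1 with h1 | h1
  · exact hδ.ne h1
  · exact h1 left_mem_uIcc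

/-- In the limit point case every square integrable solution of the inhomogeneous system is bounded
at zero, and the component on which the singular solution lives vanishes there. -/
lemma solution_bounds {q α β : ℝ → ℝ} {μ K C : ℝ} {ψ : ℝ → ℝ} (hψ : IsGauge q μ ψ K)
    (hμ : 1 / 2 ≤ μ) (hq : ContinuousOn q (Ioi 0))
    (hα : ∀ x, 0 < x → x ≤ 1 → |α x| ≤ C * x ^ (-(1 / 3) : ℝ))
    (hβ : ∀ x, 0 < x → x ≤ 1 → |β x| ≤ C * x ^ (-(1 / 3) : ℝ))
    {y z F G : ℝ → ℂ}
    (hy : IsPrimitive y (fun x => -(q x : ℂ) * y x + α x * z x + F x))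
    (hz : IsPrimitive z (fun x => (q x : ℂ) * z x + β x * y x + G x))
    (hy2 : MemLp y 2 (volume.restrict (Ioc 0 1))) (hz2 : MemLp z 2 (volume.restrict (Ioc 0 1)))
    (hF2 : MemLp F 2 (volume.restrict (Ioc 0 1))) (hG2 : MemLp G 2 (volume.restrict (Ioc 0 1))) :
    ∃ L, 0 ≤ L ∧ ∀ x, 0 < x → x ≤ 1 → ‖y x‖ ≤ L ∧ ‖z x‖ ≤ L * x ^ (1 / 6 : ℝ) := by
  have hK := hψ.const_pos
  have hC0 : 0 ≤ C := by
    have := (abs_nonneg _).trans (hα 1 one_pos le_rfl)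
    simpa using this
  have hp1 := (hψ.isPrimitive hq).mul hz
  -- The factor `ψ` cancels the singular term `q z`. What remains is `O(x ^ (μ - 1/3))` times a
  -- square integrable function.
  have hp2 : IsPrimitive (fun x => (ψ x : ℂ) * z x) (fun x => (ψ x : ℂ) * (β x * y x + G x)) :=
    hp1.congr_right fun x _ => by ring
  have hle : ∀ x, 0 < x → x ≤ 1 → ‖(ψ x : ℂ) * (β x * y x + G x)‖ ≤
      (K * (C + 1)) * x ^ (μ - 1 / 3) * (‖y x‖ + ‖G x‖) := by
    intro x hx hx1
    have h1 : 1 ≤ x ^ (-(1 / 3) : ℝ) := Real.one_le_rpow_of_pos_of_le_one_of_nonpos hx hx1 (by norm_num)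
    have h2 : ‖(β x : ℂ) * y x + G x‖ ≤ (C + 1) * x ^ (-(1 / 3) : ℝ) * (‖y x‖ + ‖G x‖) := by
      calc ‖(β x : ℂ) * y x + G x‖ ≤ |β x| * ‖y x‖ + 1 * ‖G x‖ := by
            refine (norm_add_le _ _).trans (le_of_eq ?_)
            simp
        _ ≤ ((C + 1) * x ^ (-(1 / 3) : ℝ)) * ‖y x‖ + ((C + 1) * x ^ (-(1 / 3) : ℝ)) * ‖G x‖ := by
            gcongr
            · refine (hβ x hx hx1).trans ?_
              gcongr
              linarith
            · nlinarith
        _ = _ := by ring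
    rw [norm_mul, Complex.norm_real, Real.norm_of_nonneg (hψ.pos hx).le, sub_eq_add_neg,
      Real.rpow_add hx]
    calc ψ x * ‖(β x : ℂ) * y x + G x‖
        ≤ (K * x ^ μ) * ((C + 1) * x ^ (-(1 / 3) : ℝ) * (‖y x‖ + ‖G x‖)) := by
          gcongr
          exact hψ.le hx hx1
      _ = _ := by ring
  have hg2 : IntegrableOn (fun x => (‖y x‖ + ‖G x‖) ^ 2) (Ioc 0 1) := by
    have := (hy2.norm.add hG2.norm).integrable_norm_pow (by norm_num)
    rw [IntegrableOn]
    simpa using this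
  obtain ⟨ℓ, K₁, hK₁, hlim⟩ := hp2.exists_limit_at_zero (by linarith) hg2 (by positivity) hle
  have hexp : μ - 1 / 3 + 1 / 2 = μ + 1 / 6 := by ring
  rw [hexp] at hlim
  -- Since `ψ ≤ K x ^ μ ≤ K x ^ (1/2)`, a nonzero limit of `ψ z` would give `‖z‖ ^ 2 ≥ c / x` near
  -- zero, contradicting square integrability. This is where `1/2 ≤ μ` is decisive.
  have hℓ : ℓ = 0 := by
    by_contra hne
    have hpos : 0 < ‖ℓ‖ := norm_pos_iff.2 hne
    have htend : Tendsto (fun b : ℝ => K₁ * b ^ (μ + 1 / 6)) (𝓝[>] 0) (𝓝 0) := by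
      have : Tendsto (fun b : ℝ => K₁ * b ^ (μ + 1 / 6)) (𝓝 0) (𝓝 (K₁ * (0 : ℝ) ^ (μ + 1 / 6))) :=
        ((Real.continuousAt_rpow_const _ _ (Or.inr (by positivity))).tendsto).const_mul K₁
      rw [Real.zero_rpow (by positivity), mul_zero] at this
      exact this.mono_left nhdsWithin_le_nhds
    obtain ⟨δ, ⟨hδ, hδ1⟩⟩ := ((htend.eventually (gt_mem_nhds (half_pos hpos))).and
      (Ioc_mem_nhdsGT (zero_lt_one' ℝ))).exists
    refine not_integrableOn_inv (c := (‖ℓ‖ / 2 * K⁻¹) ^ 2) (by positivity) hδ1.1 ?_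
    have hzi : IntegrableOn (fun x => ‖z x‖ ^ 2) (Ioc 0 δ) :=
      IntegrableOn.mono_set (hz2.integrable_norm_pow (by norm_num))
        (Ioc_subset_Ioc_right hδ1.2)
    refine Integrable.mono' hzi (by fun_prop) ?_
    rw [ae_restrict_iff' measurableSet_Ioc]
    refine Eventually.of_forall fun x hx => ?_
    have hx1 : x ≤ 1 := hx.2.trans hδ1.2
    have h1 : ‖ℓ‖ / 2 ≤ ‖(ψ x : ℂ) * z x‖ := by
      have h2 := hlim x hx.1 hx1
      have h3 : K₁ * x ^ (μ + 1 / 6) ≤ K₁ * δ ^ (μ + 1 / 6) := by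
        gcongr
        · exact hx.1.le
        · exact hx.2
      have h4 := norm_sub_norm_le ℓ ((ψ x : ℂ) * z x)
      rw [norm_sub_rev] at h4
      linarith
    have h2 : ‖ℓ‖ / 2 ≤ K * x ^ (1 / 2 : ℝ) * ‖z x‖ := by
      refine h1.trans ?_
      rw [norm_mul, Complex.norm_real, Real.norm_of_nonneg (hψ.pos hx.1).le]
      gcongr
      refine (hψ.le hx.1 hx1).trans ?_
      have := Real.rpow_le_rpow_of_exponent_ge hx.1 hx1 hμ
      gcongr
    have h3 : (‖ℓ‖ / 2) ^ 2 ≤ K ^ 2 * x * ‖z x‖ ^ 2 := by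
      refine (pow_le_pow_left₀ (by positivity) h2 2).trans (le_of_eq ?_)
      rw [mul_pow, mul_pow, ← Real.sqrt_eq_rpow, Real.sq_sqrt hx.1.le]
    rw [Real.norm_of_nonneg (mul_nonneg (sq_nonneg _) (inv_nonneg.2 hx.1.le)), mul_pow]
    have h4 : (‖ℓ‖ / 2) ^ 2 * K⁻¹ ^ 2 * x⁻¹ = (‖ℓ‖ / 2) ^ 2 / (K ^ 2 * x) := by
      have := hx.1.ne'
      field_simp
    rw [h4, div_le_iff₀ (mul_pos (pow_pos hK 2) hx.1)]
    linarith
  subst hℓ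
  have hzb : ∀ x, 0 < x → x ≤ 1 → ‖z x‖ ≤ K * K₁ * x ^ (1 / 6 : ℝ) := by
    intro x hx hx1
    have h1 := hlim x hx hx1
    rw [sub_zero, norm_mul, Complex.norm_real, Real.norm_of_nonneg (hψ.pos hx).le] at h1
    have h2 : ‖z x‖ = (ψ x)⁻¹ * (ψ x * ‖z x‖) := by
      rw [← mul_assoc, inv_mul_cancel₀ (hψ.pos hx).ne', one_mul]
    have h3 := Real.rpow_pos_of_pos hx (-μ)
    rw [h2]
    calc (ψ x)⁻¹ * (ψ x * ‖z x‖) ≤ (K * x ^ (-μ)) * (K₁ * x ^ (μ + 1 / 6)) := by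
          gcongr
          · exact mul_nonneg (hψ.pos hx).le (norm_nonneg _)
          · exact hψ.inv_le hx hx1
      _ = K * K₁ * (x ^ (-μ) * x ^ (μ + 1 / 6)) := by ring
      _ = _ := by rw [← Real.rpow_add hx]; ring_nf
  have hp3 := (hψ.inv.isPrimitive hq.neg).mul hy
  -- Likewise `ψ⁻¹` cancels `-q y`. Here the equation is integrated from `1` down to `x`.
  have hp4 : IsPrimitive (fun x => (((ψ x)⁻¹ : ℝ) : ℂ) * y x)
      (fun x => (((ψ x)⁻¹ : ℝ) : ℂ) * (α x * z x + F x)) :=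
    hp3.congr_right fun x _ => by push_cast; ring
  set S := ∫ x in Ioc (0 : ℝ) 1, ‖F x‖ ^ 2 with hS
  have hS0 : 0 ≤ S := setIntegral_nonneg measurableSet_Ioc fun x _ => sq_nonneg _
  set B := C * (K * K₁) with hB
  have hB0 : 0 ≤ B := by positivity
  have hyb : ∀ x, 0 < x → x ≤ 1 →
      ‖y x‖ ≤ K * ((ψ 1)⁻¹ * ‖y 1‖ + K * (B * (3 / 2) + (1 + S))) := by
    intro x hx hx1
    have hFi : IntervalIntegrable (fun x => ‖F x‖ ^ 2) volume x 1 :=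
      (intervalIntegrable_iff_integrableOn_Ioc_of_le hx1).2
        (IntegrableOn.mono_set (hF2.integrable_norm_pow (by norm_num)) (Ioc_subset_Ioc_left hx.le))
    have hri : IntervalIntegrable (fun s : ℝ => s ^ (-(1 / 3) : ℝ)) volume x 1 :=
      intervalIntegral.intervalIntegrable_rpow' (by norm_num)
    -- The bound `K s ^ (-μ)` on `ψ⁻¹` is largest at `s = x`, so it leaves the integral as `x ^
    -- (-μ)`, later compensated by `ψ x ≤ K x ^ μ`. The rest has an integral bounded independently
    -- of `x`.
    have hptw : ∀ s ∈ Ioc x 1, ‖(((ψ s)⁻¹ : ℝ) : ℂ) * (α s * z s + F s)‖ ≤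
        K * x ^ (-μ) * (B * s ^ (-(1 / 3) : ℝ) + (1 + ‖F s‖ ^ 2)) := by
      intro s hs
      have hs0 : 0 < s := hx.trans hs.1
      have h1 : (ψ s)⁻¹ ≤ K * x ^ (-μ) := by
        refine (hψ.inv_le hs0 hs.2).trans ?_
        gcongr 1
        exact Real.rpow_le_rpow_of_nonpos hx hs.1.le (by linarith)
      have h2 : ‖z s‖ ≤ K * K₁ := by
        refine (hzb s hs0 hs.2).trans ?_
        have := Real.rpow_le_one hs0.le hs.2 (by norm_num : (0 : ℝ) ≤ 1 / 6)
        exact mul_le_of_le_one_right (by positivity) this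
      have h3 : ‖(α s : ℂ) * z s + F s‖ ≤ B * s ^ (-(1 / 3) : ℝ) + (1 + ‖F s‖ ^ 2) := by
        refine (norm_add_le _ _).trans ?_
        rw [norm_mul, Complex.norm_real, Real.norm_eq_abs]
        have h4 : |α s| * ‖z s‖ ≤ (C * s ^ (-(1 / 3) : ℝ)) * (K * K₁) :=
          mul_le_mul (hα s hs0 hs.2) h2 (norm_nonneg _) (by positivity)
        have h5 : ‖F s‖ ≤ 1 + ‖F s‖ ^ 2 := by nlinarith [sq_nonneg (‖F s‖ - 1)]
        have h6 : C * s ^ (-(1 / 3) : ℝ) * (K * K₁) = B * s ^ (-(1 / 3) : ℝ) := by rw [hB]; ring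
        linarith
      rw [norm_mul, Complex.norm_real, Real.norm_of_nonneg (inv_pos.2 (hψ.pos hs0)).le]
      gcongr
    have h1 : ‖∫ s in x..1, (((ψ s)⁻¹ : ℝ) : ℂ) * (α s * z s + F s)‖ ≤
        K * x ^ (-μ) * (B * (3 / 2) + (1 + S)) := by
      refine (intervalIntegral.norm_integral_le_of_norm_le hx1 (Eventually.of_forall hptw)
        (((hri.const_mul _).add (intervalIntegrable_const.add hFi)).const_mul _)).trans ?_
      rw [intervalIntegral.integral_const_mul, intervalIntegral.integral_add (hri.const_mul _)
        (intervalIntegrable_const.add hFi), intervalIntegral.integral_const_mul,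
        intervalIntegral.integral_add intervalIntegrable_const hFi, intervalIntegral.integral_const]
      have h2 : ∫ s in x..1, s ^ (-(1 / 3) : ℝ) ≤ 3 / 2 :=
        (integral_rpow_le (by norm_num) hx hx1 le_rfl).trans (by norm_num)
      have h3 : ∫ s in x..1, ‖F s‖ ^ 2 ≤ S := by
        rw [intervalIntegral.integral_of_le hx1]
        exact setIntegral_mono_set (hF2.integrable_norm_pow (by norm_num))
          (Eventually.of_forall fun x => sq_nonneg _) (Ioc_subset_Ioc_left hx.le).eventuallyLE
      have h4 : (1 - x) • (1 : ℝ) ≤ 1 := by simp [hx.le]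
      gcongr
    have h2 : ‖(((ψ x)⁻¹ : ℝ) : ℂ) * y x‖ ≤
        (ψ 1)⁻¹ * ‖y 1‖ + K * x ^ (-μ) * (B * (3 / 2) + (1 + S)) := by
      have h3 := hp4.sub_eq hx one_pos
      have h4 : (((ψ x)⁻¹ : ℝ) : ℂ) * y x = (((ψ 1)⁻¹ : ℝ) : ℂ) * y 1 -
          ∫ s in x..1, (((ψ s)⁻¹ : ℝ) : ℂ) * (α s * z s + F s) := by
        rw [← h3]; ring
      rw [h4]
      refine (norm_sub_le _ _).trans (add_le_add (le_of_eq ?_) h1)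
      rw [norm_mul, Complex.norm_real, Real.norm_of_nonneg (inv_pos.2 (hψ.pos one_pos)).le]
    have hone : 1 ≤ x ^ (-μ) :=
      Real.one_le_rpow_of_pos_of_le_one_of_nonpos hx hx1 (by linarith)
    have hyeq : ‖y x‖ = ψ x * ‖(((ψ x)⁻¹ : ℝ) : ℂ) * y x‖ := by
      rw [norm_mul, Complex.norm_real, Real.norm_of_nonneg (inv_pos.2 (hψ.pos hx)).le, ← mul_assoc,
        mul_inv_cancel₀ (hψ.pos hx).ne', one_mul]
    have hinv : x ^ μ * x ^ (-μ) = 1 := by rw [← Real.rpow_add hx]; simp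
    have hψ1 := inv_pos.2 (hψ.pos one_pos)
    have hxμ := Real.rpow_pos_of_pos hx μ
    rw [hyeq]
    calc ψ x * ‖(((ψ x)⁻¹ : ℝ) : ℂ) * y x‖
        ≤ (K * x ^ μ) * (x ^ (-μ) * ((ψ 1)⁻¹ * ‖y 1‖ + K * (B * (3 / 2) + (1 + S)))) := by
          gcongr
          · exact hψ.le hx hx1
          · refine h2.trans ?_
            rw [mul_add]
            have : (ψ 1)⁻¹ * ‖y 1‖ ≤ x ^ (-μ) * ((ψ 1)⁻¹ * ‖y 1‖) :=
              le_mul_of_one_le_left (by positivity) hone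
            linarith
      _ = K * (x ^ μ * x ^ (-μ)) * ((ψ 1)⁻¹ * ‖y 1‖ + K * (B * (3 / 2) + (1 + S))) := by ring
      _ = _ := by rw [hinv, mul_one]
  refine ⟨max (K * K₁) (K * ((ψ 1)⁻¹ * ‖y 1‖ + K * (B * (3 / 2) + (1 + S)))),
    le_max_of_le_left (by positivity), fun x hx hx1 => ⟨(hyb x hx hx1).trans (le_max_right _ _),
      (hzb x hx hx1).trans ?_⟩⟩
  have := Real.rpow_pos_of_pos hx (1 / 6)
  gcongr
  exact le_max_left _ _

/-! ### A nonvanishing boundary form in the limit circle case -/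

lemma memLp_two_of_abs_le_rpow {f : ℝ → ℝ} (hf : ContinuousOn f (Ioi 0)) {K p : ℝ}
    (hp : -(1 / 2) < p) (hle : ∀ x, 0 < x → x ≤ 1 → |f x| ≤ K * x ^ p)
    (h0 : ∀ x, 1 ≤ x → f x = 0) : MemLp f 2 (volume.restrict (Ioi 0)) := by
  have hm : AEStronglyMeasurable f (volume.restrict (Ioi 0)) :=
    hf.aestronglyMeasurable measurableSet_Ioi
  rw [memLp_two_iff_integrable_sq hm]
  have h1 : IntegrableOn (fun x => f x ^ 2) (Ioc 0 1) := by
    have hi : IntegrableOn (fun x : ℝ => K ^ 2 * x ^ (2 * p)) (Ioc 0 1) := by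
      rw [← intervalIntegrable_iff_integrableOn_Ioc_of_le zero_le_one]
      exact (intervalIntegral.intervalIntegrable_rpow' (by linarith)).const_mul _
    refine Integrable.mono' hi ?_ ?_
    · exact (hm.mono_measure (Measure.restrict_mono Ioc_subset_Ioi_self le_rfl)).pow 2
    · rw [ae_restrict_iff' measurableSet_Ioc]
      refine Eventually.of_forall fun x hx => ?_
      rw [Real.norm_of_nonneg (sq_nonneg _), ← sq_abs]
      refine (pow_le_pow_left₀ (abs_nonneg _) (hle x hx.1 hx.2) 2).trans (le_of_eq ?_)
      rw [mul_pow, mul_comm 2 p, Real.rpow_mul hx.1.le, Real.rpow_two]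
  have h2 : IntegrableOn (fun x => f x ^ 2) (Ioi 1) := by
    refine integrableOn_zero.congr_fun (fun x hx => ?_) measurableSet_Ioi
    simp [h0 x (le_of_lt hx)]
  have := h1.union h2
  rwa [Ioc_union_Ioi_eq_Ioi zero_le_one] at this

/-- A smooth cutoff function, equal to `1` at zero and vanishing on `[1, ∞)`. -/
lemma exists_cutoff : ∃ χ χ' : ℝ → ℝ, ∃ M : ℝ, (∀ x, HasDerivAt χ (χ' x) x) ∧ Continuous χ' ∧
    (∀ x, |χ x| ≤ 1) ∧ (∀ x, 0 < x → x ≤ 1 → |χ' x| ≤ M) ∧ (∀ x, 1 ≤ x → χ x = 0) ∧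
    (∀ x, 1 ≤ x → χ' x = 0) ∧ ∫ x in Ioi 0, 2 * (χ x * χ' x) = -1 := by
  set χ : ℝ → ℝ := fun x => Real.smoothTransition (1 - x) with hχ
  have hsm : ContDiff ℝ ∞ χ := Real.smoothTransition.contDiff.comp (contDiff_const.sub contDiff_id)
  have hd (x : ℝ) : HasDerivAt χ (deriv χ x) x := ((hsm.differentiable (by simp)) x).hasDerivAt
  have hc : Continuous (deriv χ) := hsm.continuous_deriv (by simp)
  have h0 : ∀ x, 1 ≤ x → χ x = 0 := fun x hx =>
    Real.smoothTransition.zero_of_nonpos (by linarith)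
  -- Every such point is a minimum of the nonnegative `χ`; this covers the endpoint `x = 1` as well.
  have h0' : ∀ x, 1 ≤ x → deriv χ x = 0 := fun x hx => by
    refine IsLocalMin.deriv_eq_zero (Eventually.of_forall fun y => ?_)
    rw [h0 x hx]
    exact Real.smoothTransition.nonneg _
  obtain ⟨M, hM⟩ := isCompact_Icc.exists_bound_of_continuousOn (s := Icc (0 : ℝ) 1) hc.continuousOn
  refine ⟨χ, deriv χ, M, hd, hc, fun x => ?_, fun x hx hx1 => hM x ⟨hx.le, hx1⟩, h0, h0', ?_⟩
  · rw [abs_of_nonneg (Real.smoothTransition.nonneg _)]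
    exact Real.smoothTransition.le_one _
  · have h1 : ∫ x in Ioi (0 : ℝ), 2 * (χ x * deriv χ x) =
        ∫ x in Ioc (0 : ℝ) 1, 2 * (χ x * deriv χ x) := by
      refine setIntegral_eq_of_subset_of_forall_sdiff_eq_zero measurableSet_Ioi Ioc_subset_Ioi_self
        fun x hx => ?_
      have : 1 < x := by
        by_contra hle
        exact hx.2 ⟨hx.1, not_lt.1 hle⟩
      rw [h0 x this.le, zero_mul, mul_zero]
    rw [h1, ← intervalIntegral.integral_of_le zero_le_one,
      intervalIntegral.integral_eq_sub_of_hasDerivAt (f := fun x => χ x ^ 2)]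
    · rw [h0 1 le_rfl, hχ]
      simp [Real.smoothTransition.one]
    · intro x _
      have := (hd x).fun_pow 2
      rwa [show ((2 : ℕ) : ℝ) * χ x ^ (2 - 1) * deriv χ x = 2 * (χ x * deriv χ x) by
        push_cast; ring] at this
    · exact (continuous_const.mul (hsm.continuous.mul hc)).intervalIntegrable _ _

/-- In the limit circle case there are two square integrable vectors in the maximal domain, namely
`(u, 0)` and `(y, z)`, with nonvanishing boundary form. -/
lemma exists_boundary_pair {q α β ψ : ℝ → ℝ} {μ K C : ℝ} (hψ : IsGauge q μ ψ K)
    (hμ0 : 0 ≤ μ) (hμ : μ < 1 / 2)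
    (hq : ContinuousOn q (Ioi 0)) (hαc : ContinuousOn α (Ioi 0)) (hβc : ContinuousOn β (Ioi 0))
    (hα : ∀ x, 0 < x → x ≤ 1 → |α x| ≤ C * x ^ (-(1 / 3) : ℝ))
    (hβ : ∀ x, 0 < x → x ≤ 1 → |β x| ≤ C * x ^ (-(1 / 3) : ℝ)) :
    ∃ u y z u' y' z' : ℝ → ℝ,
      (∀ x, 0 < x → HasDerivAt u (u' x) x) ∧ (∀ x, 0 < x → HasDerivAt y (y' x) x) ∧
      (∀ x, 0 < x → HasDerivAt z (z' x) x) ∧ ContinuousOn u' (Ioi 0) ∧ ContinuousOn y' (Ioi 0) ∧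
      ContinuousOn z' (Ioi 0) ∧
      MemLp u 2 (volume.restrict (Ioi 0)) ∧ MemLp y 2 (volume.restrict (Ioi 0)) ∧
      MemLp z 2 (volume.restrict (Ioi 0)) ∧
      MemLp (fun x => α x * u x) 2 (volume.restrict (Ioi 0)) ∧
      MemLp (fun x => q x * u x + u' x) 2 (volume.restrict (Ioi 0)) ∧
      MemLp (fun x => α x * y x + q x * z x - z' x) 2 (volume.restrict (Ioi 0)) ∧
      MemLp (fun x => q x * y x + y' x + β x * z x) 2 (volume.restrict (Ioi 0)) ∧
      ∫ x in Ioi 0, (α x * u x * y x + (q x * u x + u' x) * z x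
        - u x * (α x * y x + q x * z x - z' x)) = -1 := by
  obtain ⟨χ, χ', M, hχd, hχc', hχ1, hχM, hχ0, hχ0', hχi⟩ := exists_cutoff
  have hχc : Continuous χ := continuous_iff_continuousAt.2 fun x => (hχd x).continuousAt
  have hK := hψ.const_pos
  have hC0 : 0 ≤ C := by
    have := (abs_nonneg _).trans (hα 1 one_pos le_rfl)
    simpa using this
  have hM0 : 0 ≤ M := (abs_nonneg _).trans (hχM 1 one_pos le_rfl)
  have hψc := hψ.continuousOn
  have hψic := hψ.inv.continuousOn
  -- The exponent `1/3 - 2ν` must be nonpositive, so that its power can be estimated by its value at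
  -- the lower limit of integration; this needs `ν ≥ 1/6`. `ψ⁻¹ = O(x ^ (-ν))` needs `ν ≥ μ`. Still
  -- `μ - 2ν > -1/2`, which keeps `α ψ Y` square integrable.
  set ν := max μ (1 / 6) with hν
  have hν1 : μ ≤ ν := le_max_left _ _
  have hν2 : 1 / 6 ≤ ν := le_max_right _ _
  have hν3 : -(1 / 2) < μ - 2 * ν := by
    rcases max_choice μ (1 / 6) with h | h <;> rw [hν, h] <;> linarith
  set k : ℝ → ℝ := fun x => β x * (ψ x)⁻¹ ^ 2 with hk
  have hkc : ContinuousOn k (Ioi 0) := hβc.mul (hψic.pow 2)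
  have hki {a b : ℝ} (ha : 0 < a) (hb : 0 < b) : IntervalIntegrable k volume a b :=
    (hkc.mono (uIcc_subset_Ioi ha hb)).intervalIntegrable
  -- Variation of constants: `(ψ Y)' = -q ψ Y - β ψ⁻¹`, so `(ψ Y, ψ⁻¹)` solves `q y + y' + β z = 0`
  -- exactly. In the other row only `α ψ Y` remains, so that away from the cutoff no term with `q`
  -- survives.
  set Y : ℝ → ℝ := fun x => ∫ s in x..1, k s with hY
  have hYd (x : ℝ) (hx : 0 < x) : HasDerivAt Y (-k x) x :=
    intervalIntegral.integral_hasDerivAt_left (hki hx one_pos)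
      (hkc.stronglyMeasurableAtFilter isOpen_Ioi x hx) (hkc.continuousAt (isOpen_Ioi.mem_nhds hx))
  have hYc : ContinuousOn Y (Ioi 0) := fun x hx => (hYd x hx).continuousAt.continuousWithinAt
  set L := C * K ^ 2 * 3 with hL
  have hL0 : 0 ≤ L := by positivity
  have hYb : ∀ x, 0 < x → x ≤ 1 → |Y x| ≤ L * x ^ (1 / 3 - 2 * ν) := by
    intro x hx hx1
    have hptw : ∀ s ∈ Ioc x 1, ‖k s‖ ≤ C * K ^ 2 * x ^ (1 / 3 - 2 * ν) * s ^ (-(2 / 3) : ℝ) := by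
      intro s hs
      have hs0 : 0 < s := hx.trans hs.1
      have h1 : (ψ s)⁻¹ ≤ K * s ^ (-ν) := by
        refine (hψ.inv_le hs0 hs.2).trans ?_
        have := Real.rpow_le_rpow_of_exponent_ge hs0 hs.2 (neg_le_neg hν1)
        gcongr
      have h2 : s ^ (1 / 3 - 2 * ν) ≤ x ^ (1 / 3 - 2 * ν) :=
        Real.rpow_le_rpow_of_nonpos hx hs.1.le (by linarith)
      have h0 := (inv_pos.2 (hψ.pos hs0)).le
      rw [hk, norm_mul, norm_pow, Real.norm_of_nonneg h0, Real.norm_eq_abs]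
      calc |β s| * (ψ s)⁻¹ ^ 2 ≤ (C * s ^ (-(1 / 3) : ℝ)) * (K * s ^ (-ν)) ^ 2 := by
            gcongr
            exact hβ s hs0 hs.2
        _ = C * K ^ 2 * (s ^ (-(1 / 3) : ℝ) * (s ^ (-ν) * s ^ (-ν))) := by ring
        _ = C * K ^ 2 * (s ^ (1 / 3 - 2 * ν) * s ^ (-(2 / 3) : ℝ)) := by
            rw [← Real.rpow_add hs0, ← Real.rpow_add hs0, ← Real.rpow_add hs0]
            congr 2
            ring
        _ ≤ C * K ^ 2 * (x ^ (1 / 3 - 2 * ν) * s ^ (-(2 / 3) : ℝ)) := by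
            gcongr
        _ = _ := by ring
    have hri : IntervalIntegrable (fun s : ℝ => s ^ (-(2 / 3) : ℝ)) volume x 1 :=
      intervalIntegral.intervalIntegrable_rpow' (by norm_num)
    rw [← Real.norm_eq_abs]
    refine (intervalIntegral.norm_integral_le_of_norm_le hx1 (Eventually.of_forall hptw)
      (hri.const_mul _)).trans ?_
    rw [intervalIntegral.integral_const_mul]
    have h3 : ∫ s in x..1, s ^ (-(2 / 3) : ℝ) ≤ 3 :=
      (integral_rpow_le (by norm_num) hx hx1 le_rfl).trans (by norm_num)
    have h4 := Real.rpow_pos_of_pos hx (1 / 3 - 2 * ν)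
    calc C * K ^ 2 * x ^ (1 / 3 - 2 * ν) * ∫ s in x..1, s ^ (-(2 / 3) : ℝ)
        ≤ C * K ^ 2 * x ^ (1 / 3 - 2 * ν) * 3 := by gcongr
      _ = _ := by rw [hL]; ring
  have hψa : ∀ x, 0 < x → x ≤ 1 → |ψ x| ≤ K * x ^ μ := fun x hx hx1 => by
    rw [abs_of_pos (hψ.pos hx)]; exact hψ.le hx hx1
  have hψia : ∀ x, 0 < x → x ≤ 1 → |(ψ x)⁻¹| ≤ K * x ^ (-μ) := fun x hx hx1 => by
    rw [abs_of_pos (inv_pos.2 (hψ.pos hx))]; exact hψ.inv_le hx hx1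
  have hmul {f g : ℝ → ℝ} {A B s t : ℝ} (hA : 0 ≤ A)
      (hf : ∀ x, 0 < x → x ≤ 1 → |f x| ≤ A * x ^ s) (hg : ∀ x, 0 < x → x ≤ 1 → |g x| ≤ B * x ^ t) :
      ∀ x, 0 < x → x ≤ 1 → |f x * g x| ≤ (A * B) * x ^ (s + t) := by
    intro x hx hx1
    rw [abs_mul, Real.rpow_add hx]
    calc |f x| * |g x| ≤ (A * x ^ s) * (B * x ^ t) :=
          mul_le_mul (hf x hx hx1) (hg x hx hx1) (abs_nonneg _)
            (mul_nonneg hA (Real.rpow_nonneg hx.le _))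
      _ = _ := by ring
  have hχa : ∀ x, 0 < x → x ≤ 1 → |χ x| ≤ 1 * x ^ (0 : ℝ) := fun x _ _ => by simpa using hχ1 x
  have hχa' : ∀ x, 0 < x → x ≤ 1 → |χ' x| ≤ M * x ^ (0 : ℝ) := fun x hx hx1 => by
    simpa using hχM x hx hx1
  refine ⟨fun x => ψ x * χ x, fun x => ψ x * Y x * χ x, fun x => (ψ x)⁻¹ * χ x,
    fun x => -(q x) * ψ x * χ x + ψ x * χ' x,
    fun x => (-(q x) * ψ x * Y x + ψ x * (-k x)) * χ x + ψ x * Y x * χ' x,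
    fun x => -(-q x) * (ψ x)⁻¹ * χ x + (ψ x)⁻¹ * χ' x,
    fun x hx => (hψ.hasDerivAt hx).mul (hχd x),
    fun x hx => ((hψ.hasDerivAt hx).mul (hYd x hx)).mul (hχd x),
    fun x hx => (hψ.inv.hasDerivAt hx).mul (hχd x), ?_, ?_, ?_, ?_, ?_, ?_, ?_, ?_, ?_, ?_, ?_⟩
  · exact ((hq.neg.mul hψc).mul hχc.continuousOn).add (hψc.mul hχc'.continuousOn)
  · exact ((((hq.neg.mul hψc).mul hYc).add (hψc.mul hkc.neg)).mul hχc.continuousOn).add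
      ((hψc.mul hYc).mul hχc'.continuousOn)
  · exact ((hq.neg.neg.mul hψic).mul hχc.continuousOn).add (hψic.mul hχc'.continuousOn)
  · exact memLp_two_of_abs_le_rpow (hψc.mul hχc.continuousOn) (by linarith)
      (hmul hK.le hψa hχa) fun x hx => by simp [hχ0 x hx]
  · exact memLp_two_of_abs_le_rpow ((hψc.mul hYc).mul hχc.continuousOn) (by linarith)
      (hmul (by positivity) (hmul hK.le hψa hYb) hχa) fun x hx => by simp [hχ0 x hx]
  · exact memLp_two_of_abs_le_rpow (hψic.mul hχc.continuousOn) (by linarith)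
      (hmul hK.le hψia hχa) fun x hx => by simp [hχ0 x hx]
  · exact memLp_two_of_abs_le_rpow (hαc.mul (hψc.mul hχc.continuousOn)) (by linarith)
      (hmul hC0 hα (hmul hK.le hψa hχa)) fun x hx => by simp [hχ0 x hx]
  · have := memLp_two_of_abs_le_rpow (hψc.mul hχc'.continuousOn) (by linarith)
      (hmul hK.le hψa hχa') fun x hx => by simp [hχ0' x hx]
    refine this.ae_eq (Eventually.of_forall fun x => ?_)
    simp only [Pi.mul_apply]
    ring
  · have h1 := memLp_two_of_abs_le_rpow (hαc.mul ((hψc.mul hYc).mul hχc.continuousOn)) (by linarith)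
      (hmul hC0 hα (hmul (by positivity) (hmul hK.le hψa hYb) hχa)) fun x hx => by simp [hχ0 x hx]
    have h2 := memLp_two_of_abs_le_rpow (hψic.mul hχc'.continuousOn) (by linarith)
      (hmul hK.le hψia hχa') fun x hx => by simp [hχ0' x hx]
    refine (h1.sub h2).ae_eq (Eventually.of_forall fun x => ?_)
    simp only [Pi.sub_apply, Pi.mul_apply]
    ring
  · have := memLp_two_of_abs_le_rpow ((hψc.mul hYc).mul hχc'.continuousOn) (by linarith)
      (hmul (by positivity) (hmul hK.le hψa hYb) hχa') fun x hx => by simp [hχ0' x hx]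
    refine this.ae_eq ?_
    rw [EventuallyEq, ae_restrict_iff' measurableSet_Ioi]
    refine Eventually.of_forall fun x hx => ?_
    have := (hψ.pos hx).ne'
    simp only [hk, Pi.mul_apply]
    field_simp
    ring
  -- The integrand collapses to `(u z)' = (χ ^ 2)'`, because the gauges in `u = ψ χ` and `z = ψ⁻¹ χ`
  -- cancel.
  · rw [← hχi]
    refine setIntegral_congr_fun measurableSet_Ioi fun x hx => ?_
    have := (hψ.pos hx).ne'
    simp only
    field_simp
    ring

namespace RWNData

variable {p : RWNData}

/-! ### The coefficients near the singularity -/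

variable (p) in
/-- The exponent `μ` such that the off-diagonal potential behaves like `-μ/x` at `x = 0`. -/
noncomputable def singularExponent (amp : ℝ) : ℝ :=
  amp * (p.Z * p.alphaS ^ 2 * (1 / (4 * Real.pi))) / (3 * √(p.rPlus * p.rMinus))

lemma rPlus_pos : 0 < p.rPlus := rMinus_pos.trans_le rMinus_le_rPlus

/-- The mass `M` cancels in the product of the radii, which is why the threshold does not depend on
it. -/
lemma rPlus_mul_rMinus (h : p.IsSubextremal ∨ p.IsExtremal) :
    p.rPlus * p.rMinus = p.G * (p.m * p.Z * p.e / (p.hbar * p.c)) ^ 2 := by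
  have hs := Real.sq_sqrt (sub_nonneg.2 (ratio_le h))
  have hG := p.G_pos.ne'; have hM := p.M_pos.ne'; have hh := p.hbar_pos.ne'; have hc := p.c_pos.ne'
  have : p.rPlus * p.rMinus = (p.G * p.M * p.m / (p.hbar * p.c)) ^ 2
      * (1 - √(1 - (p.Z : ℝ) ^ 2 * p.e ^ 2 / (p.G * p.M ^ 2)) ^ 2) := by
    unfold rPlus rMinus; ring
  rw [this, hs]
  field_simp
  ring

/-- `√(r₊ r₋)` is linear in `Z`, `e` and `m`, so `Z` and one power of `e` cancel against the
amplitude of `d`. The factor `3` comes from `x ~ r³ / (3 r₊ r₋)`. -/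
lemma abs_singularExponent_mul (h : p.IsSubextremal ∨ p.IsExtremal) (amp : ℝ) :
    |amp| * (p.e ^ 3 / (4 * Real.pi * p.m * p.c ^ 2))
      = |p.singularExponent amp| * (3 * (√p.G * p.hbar / p.c)) := by
  have hG := p.G_pos; have hM := p.M_pos; have hh := p.hbar_pos; have hc := p.c_pos
  have he := p.e_pos; have hm := p.m_pos
  have hZ : (0 : ℝ) < p.Z := by exact_mod_cast p.Z_pos
  have hx : 0 < p.m * p.Z * p.e / (p.hbar * p.c) := by positivity
  have hsG := Real.sqrt_pos.2 hG
  unfold singularExponent alphaS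
  rw [rPlus_mul_rMinus h, Real.sqrt_mul hG.le, Real.sqrt_sq hx.le, abs_div, abs_mul,
    abs_of_pos (show 0 < (p.Z : ℝ) * (p.e ^ 2 / (p.hbar * p.c)) ^ 2 * (1 / (4 * Real.pi)) by
      positivity),
    abs_of_pos (show 0 < 3 * (√p.G * (p.m * p.Z * p.e / (p.hbar * p.c))) by positivity)]
  have hpi := Real.pi_pos
  field_simp

lemma threshold_iff (h : p.IsSubextremal ∨ p.IsExtremal) (amp : ℝ) :
    |amp| * (p.e ^ 3 / (4 * Real.pi * p.m * p.c ^ 2)) ≥ 3 / 2 * (√p.G * p.hbar / p.c) ↔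
      1 / 2 ≤ |p.singularExponent amp| := by
  have hpos : 0 < √p.G * p.hbar / p.c :=
    div_pos (mul_pos (Real.sqrt_pos.2 p.G_pos) p.hbar_pos) p.c_pos
  rw [abs_singularExponent_mul h, ge_iff_le]
  constructor
  · intro h1
    by_contra! h2
    nlinarith
  · intro h1
    nlinarith

/-- The cut `R < r₋` keeps the denominators away from zero, so that the error relative to `s ^ 2 /
(r₊ r₋)` is `O(s ^ 3)` uniformly. -/
lemma integrand_bounds {R s : ℝ} (hR : R < p.rMinus) (hs0 : 0 ≤ s) (hs : s ≤ R) :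
    s ^ 2 / (p.rPlus * p.rMinus) ≤ s ^ 2 / ((p.rPlus - s) * (p.rMinus - s)) ∧
    s ^ 2 / ((p.rPlus - s) * (p.rMinus - s)) ≤ s ^ 2 / (p.rPlus * p.rMinus)
      + (p.rPlus + p.rMinus) / (p.rPlus * p.rMinus * ((p.rPlus - R) * (p.rMinus - R))) * s ^ 3 := by
  have h1 := rMinus_pos (p := p)
  have h2 := rPlus_pos (p := p)
  have h3 := rMinus_le_rPlus (p := p)
  have hR1 : 0 < p.rPlus - R := by linarith
  have hR2 : 0 < p.rMinus - R := by linarith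
  have hs1 : 0 < p.rPlus - s := by linarith
  have hs2 : 0 < p.rMinus - s := by linarith
  constructor
  · gcongr
    · linarith
    · linarith
  · have h4 : s ^ 2 / ((p.rPlus - s) * (p.rMinus - s)) - s ^ 2 / (p.rPlus * p.rMinus) =
        (p.rPlus + p.rMinus - s) * s ^ 3 /
          (p.rPlus * p.rMinus * ((p.rPlus - s) * (p.rMinus - s))) := by
      field_simp
      ring
    have h5 : (p.rPlus + p.rMinus - s) * s ^ 3 /
          (p.rPlus * p.rMinus * ((p.rPlus - s) * (p.rMinus - s))) ≤
        (p.rPlus + p.rMinus) * s ^ 3 /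
          (p.rPlus * p.rMinus * ((p.rPlus - R) * (p.rMinus - R))) := by
      gcongr
      linarith
    rw [div_mul_eq_mul_div]
    linarith

lemma xOfR_bounds (h : p.IsSubextremal ∨ p.IsExtremal) {R r : ℝ} (hR : R < p.rMinus) (hr0 : 0 < r)
    (hr : r ≤ R) :
    r ^ 3 ≤ 3 * (p.rPlus * p.rMinus) * p.xOfR r ∧
    3 * (p.rPlus * p.rMinus) * p.xOfR r ≤ r ^ 3
      + (p.rPlus + p.rMinus) / ((p.rPlus - R) * (p.rMinus - R)) * r ^ 4 := by
  have h1 := rMinus_pos (p := p)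
  have h2 := rPlus_pos (p := p)
  have h3 := rMinus_le_rPlus (p := p)
  have hR1 : 0 < p.rPlus - R := by linarith
  have hR2 : 0 < p.rMinus - R := by linarith
  have hi : IntervalIntegrable (fun s => s ^ 2 / ((p.rPlus - s) * (p.rMinus - s))) volume 0 r := by
    refine (continuousOn_integrand.mono ?_).intervalIntegrable
    rw [uIcc_of_le hr0.le]
    exact fun s hs => hs.2.trans_lt (hr.trans_lt hR)
  have hi2 : IntervalIntegrable (fun s : ℝ => s ^ 2 / (p.rPlus * p.rMinus)) volume 0 r :=
    Continuous.intervalIntegrable (by fun_prop) _ _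
  have hi3 : IntervalIntegrable (fun s : ℝ => (p.rPlus + p.rMinus) /
      (p.rPlus * p.rMinus * ((p.rPlus - R) * (p.rMinus - R))) * s ^ 3) volume 0 r :=
    Continuous.intervalIntegrable (by fun_prop) _ _
  have e2 : ∫ s in (0 : ℝ)..r, s ^ 2 / (p.rPlus * p.rMinus) = r ^ 3 / 3 / (p.rPlus * p.rMinus) := by
    rw [intervalIntegral.integral_div, integral_pow]
    norm_num
  rw [xOfR_eq h]
  constructor
  · have := intervalIntegral.integral_mono_on hr0.le hi2 hi fun s hs =>
      (integrand_bounds hR hs.1 (hs.2.trans hr)).1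
    rw [e2, div_le_iff₀ (mul_pos h2 h1)] at this
    linarith
  · have := intervalIntegral.integral_mono_on hr0.le hi (hi2.add hi3) fun s hs =>
      (integrand_bounds hR hs.1 (hs.2.trans hr)).2
    rw [intervalIntegral.integral_add hi2 hi3, e2, intervalIntegral.integral_const_mul,
      integral_pow] at this
    have hP := mul_pos h2 h1
    refine (mul_le_mul_of_nonneg_left this (by positivity)).trans ?_
    calc _ = r ^ 3 + 3 / 4 * ((p.rPlus + p.rMinus) / ((p.rPlus - R) * (p.rMinus - R)) * r ^ 4) := by
          push_cast
          field_simp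
          ring
      _ ≤ _ := by
          have : 0 ≤ (p.rPlus + p.rMinus) / ((p.rPlus - R) * (p.rMinus - R)) * r ^ 4 := by positivity
          linarith

/-- These invert `x ~ r³ / (3 r₊ r₋)` with its relative error `O(r)`, which is what limits the
remainder of the potential to `O(r⁻²) = O(x ^ (-2/3))`. -/
lemma exists_rOfX_bounds (h : p.IsSubextremal ∨ p.IsExtremal) :
    ∃ κ C : ℝ, 0 < κ ∧ 0 ≤ C ∧ ∀ x, 0 < x → x ≤ 1 →
      (p.rOfX x)⁻¹ ≤ κ * x ^ (-(1 / 3) : ℝ) ∧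
      p.rOfX x ^ 3 ≤ 3 * (p.rPlus * p.rMinus) * x ∧
      3 * (p.rPlus * p.rMinus) * x ≤ p.rOfX x ^ 3 + C * p.rOfX x ^ 4 := by
  have h1 := rMinus_pos (p := p)
  have h2 := rPlus_pos (p := p)
  have h3 := rMinus_le_rPlus (p := p)
  -- By monotonicity `r(x) ≤ r(1) < r₋` for `x ≤ 1`, so one cut serves the whole range.
  set R := p.rOfX 1 with hRdef
  have hR0 : 0 < R := (rOfX_mem h one_pos).1
  have hR : R < p.rMinus := (rOfX_mem h one_pos).2
  have hR1 : 0 < p.rPlus - R := by linarith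
  have hR2 : 0 < p.rMinus - R := by linarith
  set C := (p.rPlus + p.rMinus) / ((p.rPlus - R) * (p.rMinus - R)) with hC
  have hC0 : 0 ≤ C := by positivity
  have hP := mul_pos h2 h1
  set τ := (1 + C * R) / (3 * (p.rPlus * p.rMinus)) with hτ
  have hτ0 : 0 < τ := by positivity
  refine ⟨τ ^ (1 / 3 : ℝ), C, by positivity, hC0, fun x hx hx1 => ?_⟩
  have hr0 := (rOfX_mem h hx).1
  have hrR : p.rOfX x ≤ R := (strictMonoOn_rOfX h).monotoneOn hx (mem_Ioi.2 one_pos) hx1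
  have hb := xOfR_bounds h hR hr0 hrR
  rw [xOfR_rOfX h hx] at hb
  refine ⟨?_, hb⟩
  have h4 : x ≤ τ * p.rOfX x ^ 3 := by
    rw [hτ, div_mul_eq_mul_div, le_div_iff₀ (by positivity)]
    have : C * p.rOfX x ^ 4 ≤ C * (R * p.rOfX x ^ 3) := by
      rw [pow_succ' _ 3]
      gcongr
    linarith [hb.2]
  have h5 : x ^ (1 / 3 : ℝ) ≤ τ ^ (1 / 3 : ℝ) * p.rOfX x := by
    refine (Real.rpow_le_rpow hx.le h4 (by norm_num)).trans (le_of_eq ?_)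
    rw [Real.mul_rpow hτ0.le (by positivity), ← Real.rpow_natCast, ← Real.rpow_mul hr0.le]
    norm_num
  rw [Real.rpow_neg hx.le, ← div_eq_mul_inv, le_div_iff₀ (Real.rpow_pos_of_pos hx _),
    inv_mul_le_iff₀ hr0]
  linarith

/-- The function `√((r₊ - r) (r₋ - r)) = r f(r)`. -/
lemma f_eq (h : p.IsSubextremal ∨ p.IsExtremal) {r : ℝ} (hr : r ∈ Ioo 0 p.rMinus) :
    p.f r = √((p.rPlus - r) * (p.rMinus - r)) / r := by
  rw [f, fSq_eq h hr.1.ne', Real.sqrt_div' _ (sq_nonneg _), Real.sqrt_sq hr.1.le]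

/-- With `P = r₊ r₋` and `Q = (r₊ - r) (r₋ - r)`, `√P - √Q = (P - Q) / (√P + √Q)` and `P - Q ≤ (r₊ +
r₋) r`. -/
lemma sqrt_bounds {r : ℝ} (hr : r ∈ Ioo 0 p.rMinus) :
    √((p.rPlus - r) * (p.rMinus - r)) ≤ √(p.rPlus * p.rMinus) ∧
    √(p.rPlus * p.rMinus) - √((p.rPlus - r) * (p.rMinus - r)) ≤
      (p.rPlus + p.rMinus) / √(p.rPlus * p.rMinus) * r := by
  have h1 := rMinus_pos (p := p)
  have h2 := rPlus_pos (p := p)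
  have h3 := rMinus_le_rPlus (p := p)
  obtain ⟨hr0, hr1⟩ := hr
  have hQ : 0 ≤ (p.rPlus - r) * (p.rMinus - r) := mul_nonneg (by linarith) (by linarith)
  have hP := mul_pos h2 h1
  have hle : √((p.rPlus - r) * (p.rMinus - r)) ≤ √(p.rPlus * p.rMinus) := by
    apply Real.sqrt_le_sqrt
    nlinarith
  refine ⟨hle, ?_⟩
  have hsP := Real.sqrt_pos.2 hP
  have hsQ := Real.sqrt_nonneg ((p.rPlus - r) * (p.rMinus - r))
  rw [div_mul_eq_mul_div, le_div_iff₀ hsP]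
  have e1 := Real.mul_self_sqrt hP.le
  have e2 := Real.mul_self_sqrt hQ
  nlinarith

/-- The diagonal coefficients are `O(x ^ (-1/3))` and the off-diagonal potential is
`-μ/x + O(x ^ (-2/3))` at zero. -/
lemma exists_coeff_bounds (h : p.IsSubextremal ∨ p.IsExtremal) (k : ℤ) (amp : ℝ) :
    ∃ C : ℝ, ∀ x, 0 < x → x ≤ 1 →
      |p.coeffA x| + |p.coeffB x| ≤ C * x ^ (-(1 / 3) : ℝ) ∧
      |p.offDiag k amp x + p.singularExponent amp / x| ≤ C * x ^ (-(2 / 3) : ℝ) := by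
  have h1 := rMinus_pos (p := p)
  have h2 := rPlus_pos (p := p)
  have hP := mul_pos h2 h1
  set P := p.rPlus * p.rMinus with hPdef
  have hsP := Real.sqrt_pos.2 hP
  obtain ⟨κ, C, hκ, hC, hb⟩ := exists_rOfX_bounds h
  set D := p.Z * p.alphaS ^ 2 * (1 / (4 * Real.pi)) with hD
  set E := |(k : ℝ)| * √P + |amp * D| * ((p.rPlus + p.rMinus) / √P)
    + |amp * D / (3 * √P)| * (3 * P * C) with hE
  have hE0 : 0 ≤ E := by positivity
  set E₁ := √P + |p.Z * p.alphaS| with hE₁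
  have hE₁0 : 0 ≤ E₁ := by positivity
  refine ⟨E₁ * κ + E * κ ^ 2, fun x hx hx1 => ?_⟩
  obtain ⟨hb1, hb2, hb3⟩ := hb x hx hx1
  have hr := rOfX_mem h hx
  obtain ⟨hs1, hs2⟩ := sqrt_bounds hr
  have hf := f_eq h hr
  set r := p.rOfX x with hrdef
  have hr0 : 0 < r := hr.1
  set g := √((p.rPlus - r) * (p.rMinus - r)) with hg
  have hg0 : 0 ≤ g := Real.sqrt_nonneg _
  have hri : 0 < r⁻¹ := inv_pos.2 hr0
  have hx3 : 0 < x ^ (-(1 / 3) : ℝ) := Real.rpow_pos_of_pos hx _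
  constructor
  · have ha : |p.coeffA x| ≤ √P * r⁻¹ := by
      rw [coeffA, ← hrdef, hf, abs_of_nonneg (by positivity), div_eq_mul_inv]
      gcongr
    have hb' : |p.coeffB x| = |p.Z * p.alphaS| * r⁻¹ := by
      rw [coeffB, ← hrdef, abs_mul, one_div, abs_of_pos hri]
    calc |p.coeffA x| + |p.coeffB x| ≤ E₁ * r⁻¹ := by rw [hb', hE₁]; linarith
      _ ≤ E₁ * (κ * x ^ (-(1 / 3) : ℝ)) := by gcongr
      _ = E₁ * κ * x ^ (-(1 / 3) : ℝ) := by ring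
      _ ≤ _ := by
        gcongr
        exact le_add_of_nonneg_right (by positivity)
  · have hsplit : p.offDiag k amp x + p.singularExponent amp / x =
        k * g * r⁻¹ ^ 2 + amp * D * ((√P - g) * r⁻¹ ^ 3)
          + amp * D / (3 * √P) * (x⁻¹ - 3 * P * r⁻¹ ^ 3) := by
      have e2 : amp * D / (3 * √P) * (3 * P * r⁻¹ ^ 3) = amp * D * √P * r⁻¹ ^ 3 := by
        calc _ = amp * D * (P / √P) * r⁻¹ ^ 3 := by ring
          _ = _ := by rw [Real.div_sqrt]
      rw [offDiag, coeffC, coeffD, singularExponent, ← hrdef, hf, mul_sub, e2, ← hD, ← hPdef]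
      field_simp
      ring
    have t1 : |k * g * r⁻¹ ^ 2| ≤ |(k : ℝ)| * √P * r⁻¹ ^ 2 := by
      rw [abs_mul, abs_mul, abs_of_nonneg hg0, abs_of_pos (pow_pos hri 2)]
      gcongr
    have t2 : |amp * D * ((√P - g) * r⁻¹ ^ 3)| ≤
        |amp * D| * ((p.rPlus + p.rMinus) / √P) * r⁻¹ ^ 2 := by
      rw [abs_mul (amp * D), abs_of_nonneg (mul_nonneg (sub_nonneg.2 hs1) (pow_pos hri 3).le)]
      calc |amp * D| * ((√P - g) * r⁻¹ ^ 3)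
          ≤ |amp * D| * (((p.rPlus + p.rMinus) / √P * r) * r⁻¹ ^ 3) := by gcongr
        _ = _ := by field_simp
    have t3 : |amp * D / (3 * √P) * (x⁻¹ - 3 * P * r⁻¹ ^ 3)| ≤
        |amp * D / (3 * √P)| * (3 * P * C) * r⁻¹ ^ 2 := by
      rw [abs_mul, mul_assoc _ (3 * P * C)]
      refine mul_le_mul_of_nonneg_left ?_ (abs_nonneg _)
      have e3 : x⁻¹ - 3 * P * r⁻¹ ^ 3 = -((3 * P * x - r ^ 3) / (x * r ^ 3)) := by
        field_simp
        ring
      rw [e3, abs_neg, abs_of_nonneg (div_nonneg (by linarith) (by positivity)),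
        div_le_iff₀ (by positivity)]
      calc 3 * P * x - r ^ 3 ≤ C * r ^ 4 := by linarith
        _ = C * r * r ^ 3 := by ring
        _ ≤ C * r * (3 * P * x) := by gcongr
        _ = 3 * P * C * r⁻¹ ^ 2 * (x * r ^ 3) := by field_simp
    have hx2 : x ^ (-(2 / 3) : ℝ) = (x ^ (-(1 / 3) : ℝ)) ^ 2 := by
      rw [← Real.rpow_natCast, ← Real.rpow_mul hx.le]
      norm_num
    rw [hsplit, hx2]
    calc _ ≤ |k * g * r⁻¹ ^ 2| + |amp * D * ((√P - g) * r⁻¹ ^ 3)|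
          + |amp * D / (3 * √P) * (x⁻¹ - 3 * P * r⁻¹ ^ 3)| :=
          (abs_add_le _ _).trans (by gcongr; exact abs_add_le _ _)
      _ ≤ E * r⁻¹ ^ 2 := by rw [hE]; linarith
      _ ≤ E * (κ * x ^ (-(1 / 3) : ℝ)) ^ 2 := by gcongr
      _ = E * κ ^ 2 * (x ^ (-(1 / 3) : ℝ)) ^ 2 := by ring
      _ ≤ _ := by
        gcongr
        exact le_add_of_nonneg_left (by positivity)

end RWNData

/-! ### Boundary terms at the two endpoints -/

/-- If a boundary form vanishes at zero and is integrable at infinity, then its derivative has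
vanishing integral. -/
lemma IsPrimitive.setIntegral_Ioi_eq_zero {W I : ℝ → ℂ} (hW : IsPrimitive W I)
    (hI : IntegrableOn I (Ioi 0)) (hWi : IntegrableOn W (Ioi 0))
    (h0 : Tendsto W (𝓝[>] 0) (𝓝 0)) : ∫ x in Ioi 0, I x = 0 := by
  have hI1 : IntegrableOn I (Ioi 1) := hI.mono_set (Ioi_subset_Ioi zero_le_one)
  have hI0 : IntegrableOn I (Ioc 0 1) := hI.mono_set Ioc_subset_Ioi_self
  have htop : W 1 + ∫ x in Ioi 1, I x = 0 := by
    have h1 : Tendsto W atTop (𝓝 (W 1 + ∫ x in Ioi 1, I x)) := by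
      refine ((intervalIntegral_tendsto_integral_Ioi 1 hI1 tendsto_id).const_add (W 1)).congr' ?_
      filter_upwards [eventually_gt_atTop 0] with x hx using (hW.eqOn one_pos hx).symm
    -- Integrability of `I` gives `W` a limit at infinity; integrability of `W` forces the limit to
    -- be zero.
    refine IntegrableAtFilter.eq_zero_of_tendsto (l := atTop) (μ := volume) (f := W)
      ⟨Ioi 0, Ioi_mem_atTop 0, hWi⟩ (fun s hs => ?_) h1
    obtain ⟨b, hb⟩ := mem_atTop_sets.1 hs
    rw [← top_le_iff, ← Real.volume_Ici (a := b)]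
    exact measure_mono hb
  have hzero : W 1 = ∫ x in Ioc 0 1, I x := by
    have hint : IntegrableOn I (uIcc 0 1) := by
      rwa [uIcc_of_le zero_le_one, integrableOn_Icc_iff_integrableOn_Ioc]
    have h1 := intervalIntegral.continuousOn_primitive_interval_left hint 0 left_mem_uIcc
    rw [uIcc_of_le zero_le_one] at h1
    have h2 : Tendsto (fun x => ∫ t in x..1, I t) (𝓝[>] 0) (𝓝 (∫ t in (0 : ℝ)..1, I t)) :=
      h1.tendsto.mono_left (nhdsWithin_le_of_mem (Icc_mem_nhdsGT zero_lt_one))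
    have h3 : Tendsto (fun x => ∫ t in x..1, I t) (𝓝[>] 0) (𝓝 (W 1 - 0)) := by
      refine (h0.const_sub (W 1)).congr' ?_
      filter_upwards [self_mem_nhdsWithin] with x hx using hW.sub_eq hx one_pos
    rw [← intervalIntegral.integral_of_le zero_le_one, tendsto_nhds_unique h2 h3, sub_zero]
  rw [← Ioc_union_Ioi_eq_Ioi zero_le_one,
    setIntegral_union (Ioc_disjoint_Ioi le_rfl) measurableSet_Ioi hI0 hI1, ← hzero, htop]

lemma locallyIntegrableOn_of_memLp {u : ℝ → ℂ} (hu : MemLp u 2 (volume.restrict (Ioi 0))) :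
    LocallyIntegrableOn u (Ioi 0) := by
  rw [locallyIntegrableOn_iff isOpen_Ioi.isLocallyClosed]
  intro K hK hKc
  have : IsFiniteMeasure (volume.restrict K) := ⟨by
    rw [Measure.restrict_apply_univ]; exact hKc.measure_lt_top⟩
  exact (hu.mono_measure (Measure.restrict_mono hK le_rfl)).integrable one_le_two

namespace RWNData

variable {p : RWNData}

/-! ### Square integrable bi-spinors -/

lemma memLp_vec {f₁ f₂ : ℝ → ℝ} (h₁ : MemLp f₁ 2 (volume.restrict (Ioi 0)))
    (h₂ : MemLp f₂ 2 (volume.restrict (Ioi 0))) :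
    MemLp (fun x => (!₂[(f₁ x : ℂ), (f₂ x : ℂ)] : C2)) 2 (volume.restrict (Ioi 0)) := by
  have e₁ := (ContinuousLinearMap.toSpanSingleton ℂ (EuclideanSpace.single 0 1 : C2)).comp_memLp'
    h₁.ofReal
  have e₂ := (ContinuousLinearMap.toSpanSingleton ℂ (EuclideanSpace.single 1 1 : C2)).comp_memLp'
    h₂.ofReal
  refine (e₁.add e₂).ae_eq (Eventually.of_forall fun x => ?_)
  ext i
  fin_cases i <;> simp

lemma memLp_apply {f : ℝ → C2} (h : MemLp f 2 (volume.restrict (Ioi 0))) (i : Fin 2) :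
    MemLp (fun x => f x i) 2 (volume.restrict (Ioi 0)) :=
  (EuclideanSpace.proj (𝕜 := ℂ) i : C2 →L[ℂ] ℂ).comp_memLp' h

lemma inner_C2 (v w : C2) :
    inner ℂ v w = starRingEnd ℂ (v 0) * w 0 + starRingEnd ℂ (v 1) * w 1 := by
  simp [PiLp.inner_apply, Fin.sum_univ_two, mul_comm]

lemma inner_toLp {f g : ℝ → C2} (hf : MemLp f 2 (volume.restrict (Ioi 0)))
    (hg : MemLp g 2 (volume.restrict (Ioi 0))) :
    inner ℂ (hf.toLp f) (hg.toLp g) = ∫ x in Ioi 0, inner ℂ (f x) (g x) := by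
  rw [L2.inner_def]
  refine integral_congr_ae ?_
  filter_upwards [hf.coeFn_toLp, hg.coeFn_toLp] with x h1 h2
  rw [h1, h2]

lemma integrable_inner_of_memLp {f g : ℝ → C2} (hf : MemLp f 2 (volume.restrict (Ioi 0)))
    (hg : MemLp g 2 (volume.restrict (Ioi 0))) :
    IntegrableOn (fun x => (inner ℂ (f x) (g x) : ℂ)) (Ioi 0) := by
  refine (integrable_congr ?_).1 (L2.integrable_inner (𝕜 := ℂ) (hf.toLp f) (hg.toLp g))
  filter_upwards [hf.coeFn_toLp, hg.coeFn_toLp] with x h1 h2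
  rw [h1, h2]

/-- The test bi-spinor with `i`-th component `γ` and the other component `0`. -/
noncomputable def testSingle (i : Fin 2) (γ : ℝ → ℝ) (h1 : ContDiff ℝ ∞ γ) (h2 : HasCompactSupport γ)
    (h3 : tsupport γ ⊆ Ioi 0) : 𝓓(halfLine, C2) where
  toFun x := (γ x : ℂ) • EuclideanSpace.single i 1
  contDiff' := (Complex.ofRealCLM.contDiff.comp h1).smul contDiff_const
  hasCompactSupport' := by
    refine HasCompactSupport.intro h2 fun x hx => ?_
    rw [image_eq_zero_of_notMem_tsupport hx]
    simp
  tsupport_subset' := by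
    refine (closure_mono fun x hx => ?_).trans h3
    intro h0
    apply hx
    simp only [h0]
    simp

lemma testSingle_apply (i j : Fin 2) (γ : ℝ → ℝ) (h1 : ContDiff ℝ ∞ γ) (h2 : HasCompactSupport γ)
    (h3 : tsupport γ ⊆ Ioi 0) (x : ℝ) :
    testSingle i γ h1 h2 h3 x j = if j = i then (γ x : ℂ) else 0 := by
  change ((γ x : ℂ) • (EuclideanSpace.single i 1 : C2)) j = _
  simp

/-! ### The Dirac operator and its adjoint -/

lemma inner_testToL2 (g : 𝓓(halfLine, C2)) (w : HSpace) :
    inner ℂ (testToL2 g) w = ∫ x in Ioi 0, inner ℂ (g x) (w x) := by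
  conv_lhs => rw [← Lp.toLp_coeFn w (Lp.memLp w)]
  exact inner_toLp (memLp_testFunction g) (Lp.memLp w)

lemma inner_diracToL2 (h : p.IsSubextremal ∨ p.IsExtremal) (k : ℤ) (amp : ℝ)
    (g : 𝓓(halfLine, C2)) (w : HSpace) :
    inner ℂ (diracToL2 h k amp g) w = ∫ x in Ioi 0, inner ℂ (p.diracExpr k amp g x) (w x) := by
  conv_lhs => rw [← Lp.toLp_coeFn w (Lp.memLp w)]
  exact inner_toLp (memLp_diracExpr h k amp g) (Lp.memLp w)

lemma isAdjointPair_iff (h : p.IsSubextremal ∨ p.IsExtremal) (k : ℤ) (amp : ℝ) (u w : HSpace) :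
    IsAdjointPair (diracOp h k amp) u w ↔
      ∀ g : 𝓓(halfLine, C2), inner ℂ (diracToL2 h k amp g) u = inner ℂ (testToL2 g) w := by
  constructor
  · intro hp g
    rw [← diracOp_apply h k amp g]
    exact hp ⟨testToL2 g, LinearMap.mem_range_self _ g⟩
  · rintro hp ⟨_, g, rfl⟩
    rw [diracOp_apply h k amp g]
    exact hp g

lemma integral_Ioi_smul_eq {γ : ℝ → ℝ} (hγ : tsupport γ ⊆ Ioi 0) (w : ℝ → ℂ) :
    ∫ x in Ioi 0, γ x • w x = ∫ x, γ x • w x :=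
  setIntegral_eq_integral_of_forall_compl_eq_zero fun x hx => by
    rw [image_eq_zero_of_notMem_tsupport fun h => hx (hγ h), zero_smul]

/-- The domain of the operator is dense. -/
lemma dense_domain (h : p.IsSubextremal ∨ p.IsExtremal) (k : ℤ) (amp : ℝ) :
    Dense ((diracOp h k amp).domain : Set HSpace) := by
  rw [Submodule.dense_iff_topologicalClosure_eq_top, Submodule.topologicalClosure_eq_top_iff,
    Submodule.eq_bot_iff]
  intro u hu
  rw [Submodule.mem_orthogonal] at hu
  have hz (i : Fin 2) : ∀ᵐ x, x ∈ Ioi (0 : ℝ) → u x i = 0 := by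
    refine isOpen_Ioi.ae_eq_zero_of_integral_contDiff_smul_eq_zero
      (locallyIntegrableOn_of_memLp (memLp_apply (Lp.memLp u) i)) fun γ h1 h2 h3 => ?_
    have := hu (testToL2 (testSingle i γ h1 h2 h3)) (LinearMap.mem_range_self _ _)
    rw [inner_testToL2] at this
    rw [← integral_Ioi_smul_eq h3, ← this]
    refine integral_congr_ae (Eventually.of_forall fun x => ?_)
    simp only [inner_C2, testSingle_apply]
    fin_cases i <;> simp
  refine Lp.ext ?_
  filter_upwards [ae_restrict_of_ae (hz 0), ae_restrict_of_ae (hz 1), Lp.coeFn_zero C2 2 _,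
    ae_restrict_mem measurableSet_Ioi] with x h0 h1 h2 hx
  rw [h2]
  ext i
  fin_cases i
  · exact h0 hx
  · exact h1 hx

/-- Integration by parts: pairs of square integrable functions with primitives satisfying the
differential equation belong to the adjoint of the Dirac operator. -/
lemma isAdjointPair_toLp (h : p.IsSubextremal ∨ p.IsExtremal) (k : ℤ) (amp : ℝ) {f F : ℝ → C2}
    (hf : MemLp f 2 (volume.restrict (Ioi 0))) (hF : MemLp F 2 (volume.restrict (Ioi 0)))
    {f' : Fin 2 → ℝ → ℂ} (hp : ∀ i, IsPrimitive (fun x => f x i) (f' i))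
    (h0 : ∀ x, 0 < x → F x 0 = ((p.coeffA x - p.coeffB x : ℝ) : ℂ) * f x 0
      + (p.offDiag k amp x : ℂ) * f x 1 - f' 1 x)
    (h1 : ∀ x, 0 < x → F x 1 = (p.offDiag k amp x : ℂ) * f x 0 + f' 0 x
      + ((-p.coeffA x - p.coeffB x : ℝ) : ℂ) * f x 1) :
    IsAdjointPair (diracOp h k amp) (hf.toLp f) (hF.toLp F) := by
  rw [isAdjointPair_iff]
  intro g
  have e1 : inner ℂ (diracToL2 h k amp g) (hf.toLp f)
      = ∫ x in Ioi 0, inner ℂ (p.diracExpr k amp g x) (f x) :=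
    inner_toLp (memLp_diracExpr h k amp g) hf
  have e2 : inner ℂ (testToL2 g) (hF.toLp F) = ∫ x in Ioi 0, inner ℂ (g x) (F x) :=
    inner_toLp (memLp_testFunction g) hF
  rw [e1, e2, ← sub_eq_zero, ← integral_sub (integrable_inner_of_memLp (memLp_diracExpr h k amp g) hf)
    (integrable_inner_of_memLp (memLp_testFunction g) hF)]
  have hg (i : Fin 2) : IsPrimitive (fun x => g x i) (deriv fun x => g x i) :=
    IsPrimitive.of_hasDerivAt (fun x _ =>
      (((contDiff_comp g i).differentiable (by simp)) x).hasDerivAt)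
      ((contDiff_comp g i).continuous_deriv (by simp)).continuousOn
  -- Lagrange identity: the potentials are real and cancel, leaving the derivative of `ḡ₀ f₁ - ḡ₁
  -- f₀`, which has compact support in `(0, ∞)`.
  have hW := (((hg 0).conj.mul (hp 1)).sub ((hg 1).conj.mul (hp 0))).congr_right
    (k := fun x => inner ℂ (p.diracExpr k amp g x) (f x) - inner ℂ (g x) (F x)) (by
      intro x hx
      rw [inner_C2, inner_C2, h0 x hx, h1 x hx]
      simp only [diracExpr, PiLp.toLp_apply, Matrix.cons_val_zero, Matrix.cons_val_one, map_add,
        map_sub, map_mul, Complex.conj_ofReal]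
      ring)
  have hz : ∀ x, x ∉ tsupport g → g x = 0 := fun x hx => image_eq_zero_of_notMem_tsupport hx
  have hI : ∀ x, x ∉ tsupport g →
      (inner ℂ (p.diracExpr k amp g x) (f x) : ℂ) - inner ℂ (g x) (F x) = 0 := fun x hx => by
    rw [diracExpr_eq_zero k amp g hx, hz x hx, inner_zero_left, inner_zero_left, sub_zero]
  rw [setIntegral_eq_integral_of_forall_compl_eq_zero fun x (hx : x ∉ Ioi (0 : ℝ)) => hI x fun hx' =>
    hx (g.tsupport_subset hx')]
  exact hW.integral_eq_zero g.hasCompactSupport.isCompact g.tsupport_subset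
    (fun x hx => by simp [hz x hx]) hI

lemma isFormalAdjoint_diracOp (h : p.IsSubextremal ∨ p.IsExtremal) (k : ℤ) (amp : ℝ) :
    (diracOp h k amp).IsFormalAdjoint (diracOp h k amp) := by
  rintro u ⟨_, g, rfl⟩
  rw [diracOp_apply h k amp g]
  refine isAdjointPair_toLp h k amp (memLp_testFunction g) (memLp_diracExpr h k amp g)
    (f' := fun i => deriv fun x => g x i) (fun i => ?_) (fun x _ => ?_) (fun x _ => ?_) u
  · exact IsPrimitive.of_hasDerivAt (fun x _ =>
      (((contDiff_comp g i).differentiable (by simp)) x).hasDerivAt)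
      ((contDiff_comp g i).continuous_deriv (by simp)).continuousOn
  · simp [diracExpr]
  · simp [diracExpr]

lemma deriv_testSingle (i j : Fin 2) (γ : ℝ → ℝ) (h1 : ContDiff ℝ ∞ γ) (h2 : HasCompactSupport γ)
    (h3 : tsupport γ ⊆ Ioi 0) (x : ℝ) :
    deriv (fun y => testSingle i γ h1 h2 h3 y j) x = if j = i then ((deriv γ x : ℝ) : ℂ) else 0 := by
  simp only [testSingle_apply]
  split_ifs
  · exact ((h1.differentiable (by simp)) x).hasDerivAt.ofReal_comp.deriv
  · exact deriv_const x 0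

lemma diracExpr_testSingle_zero (k : ℤ) (amp : ℝ) (γ : ℝ → ℝ) (h1 : ContDiff ℝ ∞ γ)
    (h2 : HasCompactSupport γ) (h3 : tsupport γ ⊆ Ioi 0) (x : ℝ) :
    p.diracExpr k amp (testSingle 0 γ h1 h2 h3) x = !₂[((p.coeffA x - p.coeffB x : ℝ) : ℂ) * γ x,
      (p.offDiag k amp x : ℂ) * γ x + ((deriv γ x : ℝ) : ℂ)] := by
  rw [diracExpr, deriv_testSingle, deriv_testSingle]
  simp [testSingle_apply]

lemma diracExpr_testSingle_one (k : ℤ) (amp : ℝ) (γ : ℝ → ℝ) (h1 : ContDiff ℝ ∞ γ)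
    (h2 : HasCompactSupport γ) (h3 : tsupport γ ⊆ Ioi 0) (x : ℝ) :
    p.diracExpr k amp (testSingle 1 γ h1 h2 h3) x = !₂[(p.offDiag k amp x : ℂ) * γ x
      - ((deriv γ x : ℝ) : ℂ), ((-p.coeffA x - p.coeffB x : ℝ) : ℂ) * γ x] := by
  rw [diracExpr, deriv_testSingle, deriv_testSingle]
  simp [testSingle_apply]

/-- Reads the adjoint identity, tested on one component, as a weak differential equation. The factor
`s` absorbs the sign of `d/dx` in the corresponding entry. -/
lemma weak_of_pairing (h : p.IsSubextremal ∨ p.IsExtremal) (k : ℤ) (amp : ℝ) {u w : HSpace}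
    (g : 𝓓(halfLine, C2)) {γ : ℝ → ℝ} (h1 : ContDiff ℝ ∞ γ) (h2 : HasCompactSupport γ)
    (h3 : tsupport γ ⊆ Ioi 0)
    (hp : inner ℂ (diracToL2 h k amp g) u = inner ℂ (testToL2 g) w)
    {v f : ℝ → ℂ} (hv : LocallyIntegrableOn v (Ioi 0)) (hf : LocallyIntegrableOn f (Ioi 0)) (s : ℂ)
    (hs : ∀ x, s * (inner ℂ (g x) (w x) - inner ℂ (p.diracExpr k amp g x) (u x))
      = γ x • f x + deriv γ x • v x) :
    ∫ x, deriv γ x • v x = - ∫ x, γ x • f x := by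
  have h3' : tsupport (deriv γ) ⊆ Ioi 0 := tsupport_deriv_subset.trans h3
  have i1 := integrable_smul_of_hasCompactSupport hf h1.continuous h2 h3
  have i2 := integrable_smul_of_hasCompactSupport hv (h1.continuous_deriv (by simp)) h2.deriv h3'
  rw [inner_testToL2, inner_diracToL2, ← sub_eq_zero, ← neg_eq_zero, neg_sub, ← integral_sub
    (integrable_inner_of_memLp (memLp_testFunction g) (Lp.memLp w))
    (integrable_inner_of_memLp (memLp_diracExpr h k amp g) (Lp.memLp u))] at hp
  have hz := congrArg (s * ·) hp
  simp only [mul_zero] at hz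
  rw [← integral_const_mul] at hz
  simp only [hs] at hz
  rw [integral_add i1.integrableOn i2.integrableOn, integral_Ioi_smul_eq h3,
    integral_Ioi_smul_eq h3'] at hz
  exact eq_neg_of_add_eq_zero_right hz

/-- Elements of the domain of the adjoint are locally absolutely continuous and the adjoint acts by
the Dirac expression. -/
lemma exists_isPrimitive_of_isAdjointPair (h : p.IsSubextremal ∨ p.IsExtremal) (k : ℤ) (amp : ℝ)
    {u w : HSpace} (hp : IsAdjointPair (diracOp h k amp) u w) :
    ∃ y z : ℝ → ℂ, (∀ᵐ x, 0 < x → u x 0 = y x ∧ u x 1 = z x) ∧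
      IsPrimitive y (fun x => -(p.offDiag k amp x : ℂ) * y x
        + ((p.coeffA x + p.coeffB x : ℝ) : ℂ) * z x + w x 1) ∧
      IsPrimitive z (fun x => (p.offDiag k amp x : ℂ) * z x
        + ((p.coeffA x - p.coeffB x : ℝ) : ℂ) * y x + -w x 0) := by
  rw [isAdjointPair_iff] at hp
  have hul (i : Fin 2) := locallyIntegrableOn_of_memLp (memLp_apply (Lp.memLp u) i)
  have hwl (i : Fin 2) := locallyIntegrableOn_of_memLp (memLp_apply (Lp.memLp w) i)
  obtain ⟨hA, hB, -, -⟩ := continuousOn_coeffs h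
  have hq := continuousOn_offDiag h k amp
  have hcl : IsLocallyClosed (Ioi (0 : ℝ)) := isOpen_Ioi.isLocallyClosed
  have hmul {f : ℝ → ℝ} (hf : ContinuousOn f (Ioi 0)) (i : Fin 2) :
      LocallyIntegrableOn (fun x => (f x : ℂ) * u x i) (Ioi 0) :=
    (hul i).continuousOn_mul (Complex.continuous_ofReal.comp_continuousOn hf) hcl
  have hcongr {f g : ℝ → ℂ} (hf : LocallyIntegrableOn f (Ioi 0)) (hfg : ∀ x, f x = g x) :
      LocallyIntegrableOn g (Ioi 0) := funext hfg ▸ hf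
  have hl0 : LocallyIntegrableOn (fun x => -(p.offDiag k amp x : ℂ) * u x 0
        + ((p.coeffA x + p.coeffB x : ℝ) : ℂ) * u x 1 + w x 1) (Ioi 0) := by
    refine hcongr (((hmul hq.neg 0).add (hmul (hA.add hB) 1)).add (hwl 1)) fun x => ?_
    simp
  have hl1 : LocallyIntegrableOn (fun x => (p.offDiag k amp x : ℂ) * u x 1
        + ((p.coeffA x - p.coeffB x : ℝ) : ℂ) * u x 0 + -w x 0) (Ioi 0) := by
    refine hcongr (((hmul hq 1).add (hmul (hA.sub hB) 0)).add (hwl 0).neg) fun x => ?_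
    simp
  -- The derivative entries are off-diagonal, so a test function in the second component yields the
  -- equation for the first component of `u`.
  obtain ⟨y, hy, hyu⟩ := exists_isPrimitive_of_weak (hul 0) hl0 fun γ h1 h2 h3 => by
    refine weak_of_pairing h k amp (testSingle 1 γ h1 h2 h3) h1 h2 h3 (hp _) (hul 0) hl0 1
      fun x => ?_
    rw [inner_C2, inner_C2, diracExpr_testSingle_one]
    simp [testSingle_apply]
    ring
  obtain ⟨z, hz, hzu⟩ := exists_isPrimitive_of_weak (hul 1) hl1 fun γ h1 h2 h3 => by
    refine weak_of_pairing h k amp (testSingle 0 γ h1 h2 h3) h1 h2 h3 (hp _) (hul 1) hl1 (-1)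
      fun x => ?_
    rw [inner_C2, inner_C2, diracExpr_testSingle_zero]
    simp [testSingle_apply]
    ring
  refine ⟨y, z, ?_, ?_, ?_⟩
  · filter_upwards [hyu, hzu] with x h1 h2 hx using ⟨h1 hx, h2 hx⟩
  · refine hy.congr_ae ?_
    filter_upwards [hyu, hzu] with x h1 h2 hx
    rw [h1 hx, h2 hx]
  · refine hz.congr_ae ?_
    filter_upwards [hyu, hzu] with x h1 h2 hx
    rw [h1 hx, h2 hx]

/-! ### The limit point case -/

lemma abs_add_le_of_coeff {x B : ℝ} (h : |p.coeffA x| + |p.coeffB x| ≤ B) :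
    |p.coeffA x + p.coeffB x| ≤ B ∧ |p.coeffA x - p.coeffB x| ≤ B :=
  ⟨(abs_add_le _ _).trans h, (abs_sub _ _).trans h⟩

/-- In the limit point case one component of an element of the domain of the adjoint vanishes at
zero, and the other one stays bounded. -/
lemma adjoint_bounds (h : p.IsSubextremal ∨ p.IsExtremal) (k : ℤ) (amp : ℝ)
    (hamp : 1 / 2 ≤ |p.singularExponent amp|) {u w : HSpace} {y z : ℝ → ℂ}
    (hu : ∀ᵐ x, 0 < x → u x 0 = y x ∧ u x 1 = z x)
    (hy : IsPrimitive y (fun x => -(p.offDiag k amp x : ℂ) * y x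
        + ((p.coeffA x + p.coeffB x : ℝ) : ℂ) * z x + w x 1))
    (hz : IsPrimitive z (fun x => (p.offDiag k amp x : ℂ) * z x
        + ((p.coeffA x - p.coeffB x : ℝ) : ℂ) * y x + -w x 0)) :
    ∃ L, 0 ≤ L ∧ ∀ x, 0 < x → x ≤ 1 →
      (0 ≤ p.singularExponent amp → ‖y x‖ ≤ L ∧ ‖z x‖ ≤ L * x ^ (1 / 6 : ℝ)) ∧
      (p.singularExponent amp < 0 → ‖z x‖ ≤ L ∧ ‖y x‖ ≤ L * x ^ (1 / 6 : ℝ)) := by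
  obtain ⟨C, hC⟩ := exists_coeff_bounds h k amp
  have hq := continuousOn_offDiag h k amp
  have hα : ∀ x, 0 < x → x ≤ 1 → |p.coeffA x + p.coeffB x| ≤ C * x ^ (-(1 / 3) : ℝ) :=
    fun x hx hx1 => (abs_add_le_of_coeff (hC x hx hx1).1).1
  have hβ : ∀ x, 0 < x → x ≤ 1 → |p.coeffA x - p.coeffB x| ≤ C * x ^ (-(1 / 3) : ℝ) :=
    fun x hx hx1 => (abs_add_le_of_coeff (hC x hx hx1).1).2
  have hmono : volume.restrict (Ioc (0 : ℝ) 1) ≤ volume.restrict (Ioi 0) :=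
    Measure.restrict_mono Ioc_subset_Ioi_self le_rfl
  have hae : ∀ᵐ x ∂volume.restrict (Ioc (0 : ℝ) 1), u x 0 = y x ∧ u x 1 = z x := by
    rw [ae_restrict_iff' measurableSet_Ioc]
    filter_upwards [hu] with x hx hx1 using hx hx1.1
  have hy2 : MemLp y 2 (volume.restrict (Ioc 0 1)) :=
    ((memLp_apply (Lp.memLp u) 0).mono_measure hmono).ae_eq (hae.mono fun x hx => hx.1)
  have hz2 : MemLp z 2 (volume.restrict (Ioc 0 1)) :=
    ((memLp_apply (Lp.memLp u) 1).mono_measure hmono).ae_eq (hae.mono fun x hx => hx.2)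
  have hw0 : MemLp (fun x => -w x 0) 2 (volume.restrict (Ioc 0 1)) :=
    ((memLp_apply (Lp.memLp w) 0).mono_measure hmono).neg
  have hw1 : MemLp (fun x => w x 1) 2 (volume.restrict (Ioc 0 1)) :=
    (memLp_apply (Lp.memLp w) 1).mono_measure hmono
  rcases le_or_gt 0 (p.singularExponent amp) with hs | hs
  · rw [abs_of_nonneg hs] at hamp
    obtain ⟨ψ, K, hψ⟩ := exists_isGauge hq fun x hx hx1 => (hC x hx hx1).2
    obtain ⟨L, hL, hb⟩ := solution_bounds hψ hamp hq hα hβ hy hz hy2 hz2 hw1 hw0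
    exact ⟨L, hL, fun x hx hx1 => ⟨fun _ => hb x hx hx1, fun h => absurd hs (not_le.2 h)⟩⟩
  -- For a negative exponent the components are exchanged: this replaces `q` by `-q` and swaps the
  -- two diagonal coefficients.
  · rw [abs_of_neg hs] at hamp
    obtain ⟨ψ, K, hψ⟩ := exists_isGauge (q := fun x => -p.offDiag k amp x)
      (μ := -p.singularExponent amp) hq.neg fun x hx hx1 => by
        rw [neg_div, ← neg_add, abs_neg]
        exact (hC x hx hx1).2
    obtain ⟨L, hL, hb⟩ := solution_bounds hψ hamp hq.neg hβ hα
      (hz.congr_right fun x _ => by push_cast; ring) (hy.congr_right fun x _ => by push_cast; ring)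
      hz2 hy2 hw0 hw1
    exact ⟨L, hL, fun x hx hx1 => ⟨fun h => absurd h (not_le.2 hs), fun _ => hb x hx hx1⟩⟩

theorem isEssentiallySelfAdjoint_of_le (h : p.IsSubextremal ∨ p.IsExtremal) (k : ℤ) (amp : ℝ)
    (hamp : 1 / 2 ≤ |p.singularExponent amp|) :
    IsEssentiallySelfAdjoint (diracOp h k amp) := by
  rw [isEssentiallySelfAdjoint_iff (dense_domain h k amp) (isFormalAdjoint_diracOp h k amp)]
  intro u w v m hp₁ hp₂
  obtain ⟨y₁, z₁, hu, hy₁, hz₁⟩ := exists_isPrimitive_of_isAdjointPair h k amp hp₁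
  obtain ⟨y₂, z₂, hv, hy₂, hz₂⟩ := exists_isPrimitive_of_isAdjointPair h k amp hp₂
  obtain ⟨L₁, hL₁, hb₁⟩ := adjoint_bounds h k amp hamp hu hy₁ hz₁
  obtain ⟨L₂, hL₂, hb₂⟩ := adjoint_bounds h k amp hamp hv hy₂ hz₂
  -- Lagrange identity for two elements of the domain of the adjoint: all potential terms cancel, so
  -- the defect of symmetry is the integral of `W'`.
  have hW := ((hy₁.conj.mul hz₂).sub (hz₁.conj.mul hy₂)).congr_ae
    (k := fun x => (inner ℂ (w x) (v x) - inner ℂ (u x) (m x) : ℂ)) (by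
      filter_upwards [hu, hv] with x hxu hxv hx
      rw [inner_C2, inner_C2, (hxu hx).1, (hxu hx).2, (hxv hx).1, (hxv hx).2]
      simp only [map_add, map_mul, map_neg, Complex.conj_ofReal]
      push_cast
      ring)
  have hI : IntegrableOn (fun x => (inner ℂ (w x) (v x) - inner ℂ (u x) (m x) : ℂ)) (Ioi 0) :=
    (L2.integrable_inner (𝕜 := ℂ) w v).sub (L2.integrable_inner (𝕜 := ℂ) u m)
  have hWi : IntegrableOn (fun x => starRingEnd ℂ (y₁ x) * z₂ x - starRingEnd ℂ (z₁ x) * y₂ x)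
      (Ioi 0) := by
    have i1 : Integrable (fun x => starRingEnd ℂ (u x 0) * v x 1) (volume.restrict (Ioi 0)) :=
      MemLp.integrable_mul (memLp_apply (Lp.memLp u) 0).star (memLp_apply (Lp.memLp v) 1)
    have i2 : Integrable (fun x => starRingEnd ℂ (u x 1) * v x 0) (volume.restrict (Ioi 0)) :=
      MemLp.integrable_mul (memLp_apply (Lp.memLp u) 1).star (memLp_apply (Lp.memLp v) 0)
    refine (i1.sub i2).congr ?_
    rw [EventuallyEq, ae_restrict_iff' measurableSet_Ioi]
    filter_upwards [hu, hv] with x hxu hxv hx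
    simp only [Pi.sub_apply]
    rw [(hxu hx).1, (hxu hx).2, (hxv hx).1, (hxv hx).2]
  -- Each product pairs a bounded component with one that is `O(x ^ (1/6))`.
  have h0 : Tendsto (fun x => starRingEnd ℂ (y₁ x) * z₂ x - starRingEnd ℂ (z₁ x) * y₂ x)
      (𝓝[>] 0) (𝓝 0) := by
    have htend : Tendsto (fun b : ℝ => 2 * (L₁ * L₂) * b ^ (1 / 6 : ℝ)) (𝓝[>] 0) (𝓝 0) := by
      have : Tendsto (fun b : ℝ => 2 * (L₁ * L₂) * b ^ (1 / 6 : ℝ)) (𝓝 0)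
          (𝓝 (2 * (L₁ * L₂) * (0 : ℝ) ^ (1 / 6 : ℝ))) :=
        ((Real.continuousAt_rpow_const _ _ (Or.inr (by norm_num))).tendsto).const_mul _
      rw [Real.zero_rpow (by norm_num), mul_zero] at this
      exact this.mono_left nhdsWithin_le_nhds
    refine squeeze_zero_norm' ?_ htend
    filter_upwards [Ioc_mem_nhdsGT (zero_lt_one' ℝ)] with x hx
    have hx6 := Real.rpow_nonneg hx.1.le (1 / 6)
    refine (norm_sub_le _ _).trans ?_
    rw [norm_mul, norm_mul, RCLike.norm_conj, RCLike.norm_conj]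
    rcases le_or_gt 0 (p.singularExponent amp) with hs | hs
    · obtain ⟨a1, a2⟩ := (hb₁ x hx.1 hx.2).1 hs
      obtain ⟨a3, a4⟩ := (hb₂ x hx.1 hx.2).1 hs
      calc ‖y₁ x‖ * ‖z₂ x‖ + ‖z₁ x‖ * ‖y₂ x‖
          ≤ L₁ * (L₂ * x ^ (1 / 6 : ℝ)) + (L₁ * x ^ (1 / 6 : ℝ)) * L₂ := by gcongr
        _ = _ := by ring
    · obtain ⟨a1, a2⟩ := (hb₁ x hx.1 hx.2).2 hs
      obtain ⟨a3, a4⟩ := (hb₂ x hx.1 hx.2).2 hs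
      calc ‖y₁ x‖ * ‖z₂ x‖ + ‖z₁ x‖ * ‖y₂ x‖
          ≤ (L₁ * x ^ (1 / 6 : ℝ)) * L₂ + L₁ * (L₂ * x ^ (1 / 6 : ℝ)) := by gcongr
        _ = _ := by ring
  have hfin := hW.setIntegral_Ioi_eq_zero hI hWi h0
  rw [integral_sub (L2.integrable_inner (𝕜 := ℂ) w v) (L2.integrable_inner (𝕜 := ℂ) u m),
    sub_eq_zero] at hfin
  rw [L2.inner_def, L2.inner_def]
  exact hfin

/-! ### The limit circle case -/

lemma isPrimitive_ofReal {f f' : ℝ → ℝ} (hd : ∀ x, 0 < x → HasDerivAt f (f' x) x)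
    (hc : ContinuousOn f' (Ioi 0)) : IsPrimitive (fun x => (f x : ℂ)) (fun x => (f' x : ℂ)) :=
  IsPrimitive.of_hasDerivAt (fun x hx => (hd x hx).ofReal_comp)
    (Complex.continuous_ofReal.comp_continuousOn hc)

/-- Real valued version of `isAdjointPair_toLp`. -/
lemma isAdjointPair_vec (h : p.IsSubextremal ∨ p.IsExtremal) (k : ℤ) (amp : ℝ)
    {f₁ f₂ f₁' f₂' F₁ F₂ : ℝ → ℝ}
    (d₁ : ∀ x, 0 < x → HasDerivAt f₁ (f₁' x) x) (d₂ : ∀ x, 0 < x → HasDerivAt f₂ (f₂' x) x)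
    (c₁ : ContinuousOn f₁' (Ioi 0)) (c₂ : ContinuousOn f₂' (Ioi 0))
    (m₁ : MemLp f₁ 2 (volume.restrict (Ioi 0))) (m₂ : MemLp f₂ 2 (volume.restrict (Ioi 0)))
    (n₁ : MemLp F₁ 2 (volume.restrict (Ioi 0))) (n₂ : MemLp F₂ 2 (volume.restrict (Ioi 0)))
    (e₁ : ∀ x, F₁ x = (p.coeffA x - p.coeffB x) * f₁ x + p.offDiag k amp x * f₂ x - f₂' x)
    (e₂ : ∀ x, F₂ x = p.offDiag k amp x * f₁ x + f₁' x + (-p.coeffA x - p.coeffB x) * f₂ x) :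
    IsAdjointPair (diracOp h k amp) ((memLp_vec m₁ m₂).toLp _) ((memLp_vec n₁ n₂).toLp _) := by
  refine isAdjointPair_toLp h k amp (memLp_vec m₁ m₂) (memLp_vec n₁ n₂)
    (f' := ![fun x => (f₁' x : ℂ), fun x => (f₂' x : ℂ)]) (fun i => ?_) (fun x _ => ?_)
    (fun x _ => ?_)
  · fin_cases i
    · exact isPrimitive_ofReal d₁ c₁
    · exact isPrimitive_ofReal d₂ c₂
  · simp [e₁]
  · simp [e₂]

lemma inner_vec {f₁ f₂ g₁ g₂ : ℝ → ℝ}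
    (m₁ : MemLp f₁ 2 (volume.restrict (Ioi 0))) (m₂ : MemLp f₂ 2 (volume.restrict (Ioi 0)))
    (n₁ : MemLp g₁ 2 (volume.restrict (Ioi 0))) (n₂ : MemLp g₂ 2 (volume.restrict (Ioi 0))) :
    inner ℂ ((memLp_vec m₁ m₂).toLp _ : HSpace) ((memLp_vec n₁ n₂).toLp _)
      = ((∫ x in Ioi 0, (f₁ x * g₁ x + f₂ x * g₂ x) : ℝ) : ℂ) := by
  rw [inner_toLp, ← integral_complex_ofReal]
  refine integral_congr_ae (Eventually.of_forall fun x => ?_)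
  simp [inner_C2]

lemma integrable_vec {f₁ f₂ g₁ g₂ : ℝ → ℝ}
    (m₁ : MemLp f₁ 2 (volume.restrict (Ioi 0))) (m₂ : MemLp f₂ 2 (volume.restrict (Ioi 0)))
    (n₁ : MemLp g₁ 2 (volume.restrict (Ioi 0))) (n₂ : MemLp g₂ 2 (volume.restrict (Ioi 0))) :
    IntegrableOn (fun x => f₁ x * g₁ x + f₂ x * g₂ x) (Ioi 0) :=
  (MemLp.integrable_mul m₁ n₁).add (MemLp.integrable_mul m₂ n₂)

/-- The vectors of `exists_boundary_pair` belong to the domain of the adjoint, and symmetry would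
force their boundary integral `-1` to be zero. -/
theorem not_isEssentiallySelfAdjoint_of_lt (h : p.IsSubextremal ∨ p.IsExtremal) (k : ℤ) (amp : ℝ)
    (hamp : |p.singularExponent amp| < 1 / 2) :
    ¬ IsEssentiallySelfAdjoint (diracOp h k amp) := by
  rw [isEssentiallySelfAdjoint_iff (dense_domain h k amp) (isFormalAdjoint_diracOp h k amp)]
  intro hsym
  obtain ⟨C, hC⟩ := exists_coeff_bounds h k amp
  obtain ⟨hA, hB, -, -⟩ := continuousOn_coeffs h
  have hq := continuousOn_offDiag h k amp
  have zero_memLp : MemLp (fun _ : ℝ => (0 : ℝ)) 2 (volume.restrict (Ioi 0)) := MemLp.zero'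
  have hα : ∀ x, 0 < x → x ≤ 1 → |p.coeffA x - p.coeffB x| ≤ C * x ^ (-(1 / 3) : ℝ) :=
    fun x hx hx1 => (abs_add_le_of_coeff (hC x hx hx1).1).2
  have hβ : ∀ x, 0 < x → x ≤ 1 → |-p.coeffA x - p.coeffB x| ≤ C * x ^ (-(1 / 3) : ℝ) :=
    fun x hx hx1 => by
      rw [← abs_neg, neg_sub, sub_neg_eq_add, add_comm]
      exact (abs_add_le_of_coeff (hC x hx hx1).1).1
  rcases le_or_gt 0 (p.singularExponent amp) with hs | hs
  · rw [abs_of_nonneg hs] at hamp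
    obtain ⟨ψ, K, hψ⟩ := exists_isGauge hq fun x hx hx1 => (hC x hx hx1).2
    obtain ⟨u, y, z, u', y', z', du, dy, dz, cu, cy, cz, mu, my, mz, n1, n2, n3, n4, hint⟩ :=
      exists_boundary_pair hψ hs hamp hq (hA.sub hB) (hA.neg.sub hB) hα hβ
    have h1 := isAdjointPair_vec h k amp du (fun x _ => hasDerivAt_const x (0 : ℝ)) cu
      continuousOn_const mu zero_memLp n1 n2 (fun x => by simp) (fun x => by simp)
    have h2 := isAdjointPair_vec h k amp dy dz cy cz my mz n3 n4 (fun x => rfl) (fun x => rfl)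
    have h3 := hsym _ _ _ _ h1 h2
    rw [inner_vec n1 n2 my mz, inner_vec mu zero_memLp n3 n4, Complex.ofReal_inj, ← sub_eq_zero,
      ← integral_sub (integrable_vec n1 n2 my mz) (integrable_vec mu zero_memLp n3 n4)] at h3
    have h4 : (-1 : ℝ) = 0 := by
      refine hint.symm.trans (Eq.trans ?_ h3)
      refine integral_congr_ae (Eventually.of_forall fun x => ?_)
      simp only [Pi.sub_apply]
      ring
    norm_num at h4
  -- Exchanging the components turns the Dirac expression into the negative of one of the same form,
  -- with `-q` for `q` and diagonal entries exchanged and negated. The vectors become `(0, u)` and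
  -- `(z, y)`, and their images change sign.
  · rw [abs_of_neg hs] at hamp
    obtain ⟨ψ, K, hψ⟩ := exists_isGauge (q := fun x => -p.offDiag k amp x)
      (μ := -p.singularExponent amp) hq.neg fun x hx hx1 => by
        rw [neg_div, ← neg_add, abs_neg]
        exact (hC x hx hx1).2
    obtain ⟨u, y, z, u', y', z', du, dy, dz, cu, cy, cz, mu, my, mz, n1, n2, n3, n4, hint⟩ :=
      exists_boundary_pair (α := fun x => -(-p.coeffA x - p.coeffB x))
        (β := fun x => -(p.coeffA x - p.coeffB x)) hψ (by linarith) hamp hq.neg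
        (hA.neg.sub hB).neg (hA.sub hB).neg (fun x hx hx1 => by rw [abs_neg]; exact hβ x hx hx1)
        (fun x hx hx1 => by rw [abs_neg]; exact hα x hx hx1)
    have h1 := isAdjointPair_vec h k amp (fun x _ => hasDerivAt_const x (0 : ℝ)) du
      continuousOn_const cu zero_memLp mu n2.neg n1.neg
      (fun x => by simp only [Pi.neg_apply]; ring) (fun x => by simp only [Pi.neg_apply]; ring)
    have h2 := isAdjointPair_vec h k amp dz dy cz cy mz my n4.neg n3.neg
      (fun x => by simp only [Pi.neg_apply]; ring) (fun x => by simp only [Pi.neg_apply]; ring)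
    have h3 := hsym _ _ _ _ h1 h2
    rw [inner_vec n2.neg n1.neg mz my, inner_vec zero_memLp mu n4.neg n3.neg,
      Complex.ofReal_inj, ← sub_eq_zero,
      ← integral_sub (integrable_vec n2.neg n1.neg mz my)
        (integrable_vec zero_memLp mu n4.neg n3.neg)] at h3
    have h4 : (-1 : ℝ) = 0 := by
      rw [← neg_eq_zero, ← integral_neg] at h3
      refine hint.symm.trans (Eq.trans ?_ h3)
      refine integral_congr_ae (Eventually.of_forall fun x => ?_)
      simp only [Pi.neg_apply]
      ring
    norm_num at h4

end RWNData

/-! ### The threshold for essential self-adjointness -/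

theorem mainTheorem2 (p : RWNData) (h : p.IsSubextremal ∨ p.IsExtremal) (k : ℤ) (hk : k ≠ 0)
    (amp : ℝ) :
    IsEssentiallySelfAdjoint (RWNData.diracOp h k amp) ↔
      |amp| * (p.e ^ 3 / (4 * Real.pi * p.m * p.c ^ 2)) ≥ 3 / 2 * (√p.G * p.hbar / p.c) := by
  rw [RWNData.threshold_iff h amp]
  refine ⟨fun hesa => ?_, RWNData.isEssentiallySelfAdjoint_of_le h k amp⟩
  by_contra! hlt
  exact RWNData.not_isEssentiallySelfAdjoint_of_lt h k amp hlt hesa
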